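/- \textbf{Definitions.} A \emph{full binary tree} is a pointed oriented graph $(X, r_X\in X, {\prec}\subseteq X^2)$ such that every node $x$ has either no child or exactly two children (nodes $y$ with $x\prec y$), and for every node $y$ there is exactly one path $r_X=x_0\prec x_1\prec\cdots\prec x_n=y$. A \emph{branch} of $X$ is an infinite sequence $r_X=x_0\prec x_1\prec x_2\prec\cdots$. For a set $I$, an \emph{$I$-tree} is a full binary tree together with a partial function from its set of branches to $I$. It is \emph{finitary} if it has finitely many branches, finitely many nodes whose parent is not on a branch, and every branch is labeled. An \emph{embedding} of $I$-trees is an injective, root-preserving graph embedding that preserves the labels of branches. Let $\mathcal T_I$ be the (essentially small) category of finitary $I$-trees and embeddings. The \emph{atomic topology} $J_{\mathrm{at}}$ on a category is the one whose covering sieves are the nonempty sieves (it is a Grothendieck topology when every cospan can be completed to a commutative square). A \emph{topos} is a category equivalent to the category of sheaves of sets on a small site. A \emph{geometric morphism} $\mathcal E\to\mathcal F$ is a functor $\mathcal E\to\mathcal F$ with a left adjoint (its \emph{inverse image}) that preserves finite limits. A \emph{point} of $\mathcal E$ is a geometric morphism $\mathbf{Set}\to\mathcal E$, and $\mathcal E$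 has \emph{enough points} if the inverse images of its points jointly reflect isomorphisms. A topos $\mathcal E$ is \emph{connected} if the inverse image of its geometric morphism $\mathcal E\to\mathbf{Set}$ is fully faithful, and \emph{atomic} if this inverse image is a logical functor, i.e. preserves finite limits and power objects. It is \emph{locally finitely presentable} if it is cocomplete and has a small set of finitely presentable objects of which every object is a filtered colimit. \textbf{Theorem.} Let $I$ be a set with $|I|>2^{\aleph_0}$. Then $\mathcal T_I^{\mathrm{op}}$ satisfies the condition above, so that $J_{\mathrm{at}}$ is a topology on it, and the Malitz--Gregory topos $\mathrm{Sh}(\mathcal T_I^{\mathrm{op}},J_{\mathrm{at}})$ is a connected locally finitely presentable atomic topos with no points. In particular it does not have enough points, and the Di Liberti--Rogers conjecture, that every locally finitely presentable topos has enough points, is false. -/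

import Mathlib

open CategoryTheory CategoryTheory.Limits Opposite

universe u v₁ v₂ u₁ u₂

/-! ### Geometric morphisms, points, and properties of toposes -/

/-- A geometric morphism from `E` to `F`: a functor `E ⥤ F` together with a left adjoint which
preserves finite limits. -/
structure GeometricMorphism (E : Type u₁) [Category.{v₁} E] (F : Type u₂) [Category.{v₂} F] where
  directImage : E ⥤ F
  inverseImage : F ⥤ E
  adj : inverseImage ⊣ directImage
  preservesFiniteLimits : PreservesFiniteLimits inverseImage

/-- A point of a topos `E` is a geometric morphism from the topos of sets to `E`. -/
abbrev ToposPoint (E : Type (u + 1)) [Category.{u} E] : Type (u + 1) :=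
  GeometricMorphism (Type u) E

/-- A topos (sheaf topos): a category equivalent to the category of sheaves of sets on a
small site. -/
def IsSheafTopos (E : Type (u + 1)) [Category.{u} E] : Prop :=
  ∃ (C : Type u) (_ : SmallCategory C) (J : GrothendieckTopology C),
    Nonempty (E ≌ Sheaf J (Type u))

/-- The pair of morphisms `a : R ⟶ A`, `b : R ⟶ B` is a relation from `A` to `B`, that is, it is
jointly monic (`R` is a subobject of the product of `A` and `B`). -/
def IsRelation {C : Type u₁} [Category.{v₁} C] {R A B : C} (a : R ⟶ A) (b : R ⟶ B) : Prop :=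
  ∀ ⦃T : C⦄ (f g : T ⟶ R), f ≫ a = g ≫ a → f ≫ b = g ≫ b → f = g

/-- `P`, with the relation `(mem_A, mem_P) : R ⟶ A × P`, is a power object of `A`: every relation
from `A` to an object `X` is, for a unique morphism `χ : X ⟶ P`, the inverse image of `R` along
`A × χ : A × X ⟶ A × P`. The inverse image of `R` along `A × χ` is the pullback of `R ⟶ P`
along `χ`, equipped with the composite projection to `A`, so that no product is mentioned. -/
structure IsPowerObject {C : Type u₁} [Category.{v₁} C] {A P R : C}
    (mem_A : R ⟶ A) (mem_P : R ⟶ P) : Prop where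
  isRelation : IsRelation mem_A mem_P
  existsUnique_classifying : ∀ ⦃X S : C⦄ (s : S ⟶ A) (x : S ⟶ X), IsRelation s x →
    ∃! χ : X ⟶ P, ∃ t : S ⟶ R, t ≫ mem_A = s ∧ IsPullback t x mem_P χ

/-- A logical functor: it preserves finite limits and power objects. -/
structure IsLogicalFunctor {C : Type u₁} [Category.{v₁} C] {D : Type u₂} [Category.{v₂} D]
    (F : C ⥤ D) : Prop where
  preservesFiniteLimits : PreservesFiniteLimits F
  map_isPowerObject : ∀ ⦃A P R : C⦄ (mem_A : R ⟶ A) (mem_P : R ⟶ P),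
    IsPowerObject mem_A mem_P → IsPowerObject (F.map mem_A) (F.map mem_P)

/-- A topos is atomic if its geometric morphism to the topos of sets (which is unique up to
isomorphism) is atomic, that is, has a logical inverse image functor. -/
def IsAtomicTopos (E : Type (u + 1)) [Category.{u} E] : Prop :=
  ∃ γ : GeometricMorphism E (Type u), IsLogicalFunctor γ.inverseImage

/-- A topos is connected if its geometric morphism to the topos of sets (which is unique up to
isomorphism) is connected, that is, has a fully faithful inverse image functor. -/
def IsConnectedTopos (E : Type (u + 1)) [Category.{u} E] : Prop :=
  ∃ γ : GeometricMorphism E (Type u), γ.inverseImage.Full ∧ γ.inverseImage.Faithful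

/-- A topos has enough points if the inverse image functors of its points jointly reflect
isomorphisms. -/
def HasEnoughToposPoints (E : Type (u + 1)) [Category.{u} E] : Prop :=
  ∀ ⦃X Y : E⦄ (f : X ⟶ Y), (∀ p : ToposPoint E, IsIso (p.inverseImage.map f)) → IsIso f

/-- The Di Liberti--Rogers conjecture: every locally finitely presentable topos has enough
points. -/
def DiLibertiRogersConjecture : Prop :=
  ∀ (E : Type (u + 1)) [Category.{u} E], IsSheafTopos E →
    IsLocallyFinitelyPresentable.{u} E → HasEnoughToposPoints E

/-! ### Full binary trees and labeled trees -/

/-- A full binary tree: a pointed oriented graph in which each node has either no child or exactly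
two, and such that there is exactly one path `root = x₀ ≺ x₁ ≺ ⋯ ≺ xₙ = y` to each node `y`
(the list `l` below is `[x₁, …, xₙ]`). The relation `Child x y` is `x ≺ y`. -/
structure FullBinaryTree where
  Node : Type u
  root : Node
  Child : Node → Node → Prop
  children : ∀ x, {y | Child x y} = ∅ ∨ {y | Child x y}.ncard = 2
  existsUnique_path : ∀ y, ∃! l : List Node,
    List.IsChain Child (root :: l) ∧ (root :: l).getLast (List.cons_ne_nil root l) = y

namespace FullBinaryTree

/-- A branch is an infinite sequence `root = x₀ ≺ x₁ ≺ x₂ ≺ ⋯`. -/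
abbrev Branch (X : FullBinaryTree.{u}) : Type u :=
  {b : ℕ → X.Node // b 0 = X.root ∧ ∀ n, X.Child (b n) (b (n + 1))}

/-- An embedding of full binary trees: an embedding of graphs which preserves the root. -/
@[ext]
structure Embedding (X Y : FullBinaryTree.{u}) where
  toFun : X.Node → Y.Node
  injective : Function.Injective toFun
  map_root : toFun X.root = Y.root
  map_child : ∀ x y, Y.Child (toFun x) (toFun y) ↔ X.Child x y

/-- The image of a branch under an embedding. -/
def Embedding.mapBranch {X Y : FullBinaryTree.{u}} (f : Embedding X Y) (b : X.Branch) :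
    Y.Branch :=
  ⟨fun n => f.toFun (b.1 n), (congrArg f.toFun b.2.1).trans f.map_root, fun n => (f.map_child _ _).2 (b.2.2 n)⟩

/-- A full binary tree has countably many nodes. -/
theorem countable_node (X : FullBinaryTree.{u}) : Countable X.Node := by
  let level : ℕ → Set X.Node := fun n =>
    Nat.rec {X.root} (fun _ L => ⋃ x ∈ L, {y | X.Child x y}) n
  have hfin : ∀ n, (level n).Countable := by
    intro n
    induction n with
    | zero => exact Set.countable_singleton _
    | succ n ih =>
      refine Set.Countable.biUnion ih fun x _ => ?_
      rcases X.children x with h | h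
      · rw [h]; exact Set.countable_empty
      · exact (Set.finite_of_ncard_ne_zero (by omega)).countable
  have hpath : ∀ (l : List X.Node) (x : X.Node), x ∈ ⋃ n, level n →
      List.IsChain X.Child (x :: l) →
      (x :: l).getLast (List.cons_ne_nil x l) ∈ ⋃ n, level n := by
    intro l
    induction l with
    | nil => intro x hx _; simpa using hx
    | cons y l ih =>
      intro x hx hc
      rw [List.isChain_cons_cons] at hc
      rw [List.getLast_cons (List.cons_ne_nil y l)]
      refine ih y ?_ hc.2
      obtain ⟨n, hn⟩ := Set.mem_iUnion.1 hx
      exact Set.mem_iUnion.2 ⟨n + 1, Set.mem_biUnion hn hc.1⟩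
  have huniv : (⋃ n, level n) = Set.univ := by
    refine Set.eq_univ_of_forall fun y => ?_
    obtain ⟨l, ⟨hl, rfl⟩, -⟩ := X.existsUnique_path y
    exact hpath l X.root (Set.mem_iUnion.2 ⟨0, rfl⟩) hl
  rw [← Set.countable_univ_iff, ← huniv]
  exact Set.countable_iUnion hfin

end FullBinaryTree

/-- An `I`-tree is a full binary tree equipped with a partial function from its branches to `I`
(the value `none` means that the branch has no label). -/
structure LabeledTree (I : Type u) extends FullBinaryTree.{u} where
  label : toFullBinaryTree.Branch → Option I

namespace LabeledTree

variable {I : Type u}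

/-- An embedding of `I`-trees: an embedding of full binary trees which preserves the labels. -/
@[ext]
structure Hom (X Y : LabeledTree I) extends
    FullBinaryTree.Embedding X.toFullBinaryTree Y.toFullBinaryTree where
  map_label : ∀ (b : X.Branch) (i : I), X.label b = some i →
    Y.label (toEmbedding.mapBranch b) = some i

/-- The category of `I`-trees and their embeddings. -/
instance : Category.{u} (LabeledTree I) where
  Hom := Hom
  id X :=
    { toFun := id
      injective := Function.injective_id
      map_root := rfl
      map_child := fun _ _ => Iff.rfl
      map_label := fun _ _ h => h }
  comp f g :=
    { toFun := g.toFun ∘ f.toFun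
      injective := g.injective.comp f.injective
      map_root := (congrArg g.toFun f.map_root).trans g.map_root
      map_child := fun x y => (g.map_child _ _).trans (f.map_child x y)
      map_label := fun b i h => g.map_label (f.mapBranch b) i (f.map_label b i h) }

/-- An `I`-tree is finitary if it has finitely many branches, finitely many elements whose parent
is not on a branch, and a total labeling function. -/
structure IsFinitary (X : LabeledTree I) : Prop where
  finite_branch : Finite X.Branch
  finite_off_branch :
    {y : X.Node | ∃ x, X.Child x y ∧ ∀ (b : X.Branch) (n : ℕ), b.1 n ≠ x}.Finite
  label_isSome : ∀ b : X.Branch, (X.label b).isSome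

/-- A bijection that respects the whole structure is an isomorphism of `I`-trees. -/
theorem nonempty_iso {X Y : LabeledTree I} (e : X.Node ≃ Y.Node) (hr : e X.root = Y.root)
    (hc : ∀ x y, Y.Child (e x) (e y) ↔ X.Child x y)
    (hl : ∀ (b : X.Branch) (c : Y.Branch), (∀ n, c.1 n = e (b.1 n)) → X.label b = Y.label c) :
    Nonempty (X ≅ Y) := by
  let f : Hom X Y :=
    { toFun := e
      injective := e.injective
      map_root := hr
      map_child := hc
      map_label := fun b i h => by rw [← h]; exact (hl b _ fun _ => rfl).symm }
  let g : Hom Y X :=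
    { toFun := e.symm
      injective := e.symm.injective
      map_root := by rw [← hr, e.symm_apply_apply]
      map_child := fun x y => by rw [← hc, e.apply_symm_apply, e.apply_symm_apply]
      map_label := fun b i h => by
        rw [← h]; exact hl _ _ fun n => (e.apply_symm_apply (b.1 n)).symm }
  exact ⟨⟨f, g, Hom.ext (funext e.symm_apply_apply), Hom.ext (funext e.apply_symm_apply)⟩⟩

open Classical in
/-- Since trees are countable, the category of `I`-trees is essentially small. -/
instance essentiallySmall : EssentiallySmall.{u} (LabeledTree I) := by
  rw [essentiallySmall_iff]
  refine ⟨?_, inferInstance⟩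
  choose num hnum using fun X : LabeledTree I => X.countable_node.exists_injective_nat
  let code : LabeledTree I → Set ℕ × ℕ × (ℕ → ℕ → Prop) × ((ℕ → ℕ) → Option I) := fun X =>
    (Set.range (num X), num X X.root,
      (fun m n => ∃ x y, num X x = m ∧ num X y = n ∧ X.Child x y),
      fun s => if h : ∃ b : X.Branch, ∀ n, num X (b.1 n) = s n then X.label h.choose else none)
  have hcode : ∀ X Y : LabeledTree I, code X = code Y → Nonempty (X ≅ Y) := by
    intro X Y h
    simp only [code, Prod.mk.injEq] at h
    obtain ⟨hS, hr, hc, hl⟩ := h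
    let e : X.Node ≃ Y.Node := (Equiv.ofInjective _ (hnum X)).trans
      ((Equiv.setCongr hS).trans (Equiv.ofInjective _ (hnum Y)).symm)
    have he : ∀ x, num Y (e x) = num X x := by
      intro x
      have := Equiv.apply_ofInjective_symm (hnum Y)
        ((Equiv.setCongr hS) (Equiv.ofInjective _ (hnum X) x))
      simpa [e] using this
    have hch : ∀ (Z : LabeledTree I) (x y : Z.Node),
        (∃ x' y', num Z x' = num Z x ∧ num Z y' = num Z y ∧ Z.Child x' y') ↔ Z.Child x y := by
      intro Z x y
      constructor
      · rintro ⟨x', y', hx, hy, h⟩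
        rwa [hnum Z hx, hnum Z hy] at h
      · intro h
        exact ⟨x, y, rfl, rfl, h⟩
    have hlab : ∀ (Z : LabeledTree I) (b : Z.Branch) (s : ℕ → ℕ), (∀ n, num Z (b.1 n) = s n) →
        (if h : ∃ b : Z.Branch, ∀ n, num Z (b.1 n) = s n then Z.label h.choose else none) =
          Z.label b := by
      intro Z b s hs
      have h : ∃ b : Z.Branch, ∀ n, num Z (b.1 n) = s n := ⟨b, hs⟩
      rw [dif_pos h]
      congr 1
      exact Subtype.ext (funext fun n => hnum Z ((h.choose_spec n).trans (hs n).symm))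
    refine nonempty_iso e (hnum Y ((he _).trans hr)) (fun x y => ?_) fun b c hbc => ?_
    · rw [← hch Y, ← hch X, he, he]
      exact (iff_of_eq (congrFun (congrFun hc (num X x)) (num X y))).symm
    · rw [← hlab X b (fun n => num X (b.1 n)) fun _ => rfl,
        ← hlab Y c (fun n => num X (b.1 n)) fun n => by rw [hbc, he]]
      exact congrFun hl _
  refine small_of_injective (f := fun x : Skeleton (LabeledTree I) => code (Quotient.out x)) ?_
  intro x y hxy
  obtain ⟨i⟩ := hcode _ _ hxy
  rw [← Quotient.out_eq x, ← Quotient.out_eq y]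
  exact Quotient.sound ⟨i⟩

end LabeledTree

/-- The category of finitary `I`-trees and their embeddings. -/
abbrev FinitaryTree (I : Type u) : Type (u + 1) :=
  ObjectProperty.FullSubcategory (fun X : LabeledTree I => X.IsFinitary)

instance FinitaryTree.essentiallySmall (I : Type u) : EssentiallySmall.{u} (FinitaryTree I) :=
  essentiallySmall_of_fully_faithful
    (ObjectProperty.ι (fun X : LabeledTree I => X.IsFinitary))

/-- The underlying category of the Malitz--Gregory site: the opposite of (a small category
equivalent to) the category of finitary `I`-trees and embeddings. -/
abbrev MalitzGregorySite (I : Type u) : Type u := (SmallModel.{u} (FinitaryTree I))ᵒᵖ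

/-- The Malitz--Gregory topos over `I`: the sheaves of sets for the atomic topology, whose covering
sieves are the nonempty ones; this is a topology because of the Ore condition `ore`. -/
abbrev MalitzGregoryTopos (I : Type u)
    (ore : GrothendieckTopology.RightOreCondition (MalitzGregorySite I)) : Type (u + 1) :=
  Sheaf (GrothendieckTopology.atomic ore) (Type u)

/-! No points: a point restricts to a flat functor `F` on the site. Every morphism of an atomic site
is a cover and the site has a terminal object (the one-node tree), so all values of `F` are
nonempty. Choose for each `i` an element of `F` at the comb, a tree whose only branch is labeled
`i`. The trees indexed by the elements of `F` form a filtered system, whose union would be a binary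
tree with a branch for each `i`. Embeddings preserve labels, so these branches are distinct; but a
binary tree has at most continuum many branches. `mk_le_continuum_of_isCofiltered_elements` runs
this count without forming the union.

Local finite presentability: a sheaf is a presheaf in which compatible elements descend along each
single morphism (`isSheaf_atomic_iff`). Compatibility is a condition on infinitely many pairs of
morphisms, but under `HasFiniteLinkingFamilies` finitely many pairs imply all of them. Such
conditions are reached at one stage of a filtered colimit, so sheaves are closed under filtered
colimits of presheaves.

The combinatorial core is `LabeledTree.IsFinitary.exists_finite_linking`. Given `g` and `h` from `Y`
to `W` agreeing on `X`, amalgamate `W` over `X` with a generic further copy `k` of `Y`, whose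
branches outside `X` leave those of `g` and `h` before a depth `M` depending only on `X → Y`. Past
`M`, the copy `k` meets `g` and `h` only where `X` forces it to, so there are finitely many possible
intersection patterns, and the union of two ranges is determined by its pattern. The copy is made
generic by a diagonal sequence (`exists_seq_ne`) twisting a coding of `Y` by binary words.

Connectedness and atomicity are formal: constant presheaves are already sheaves, and relations from
a constant sheaf are classified objectwise. -/

section AtomicSite

/-! ### Atomic sheaves and their filtered colimits -/

variable {C : Type u} [SmallCategory C] (ore : GrothendieckTopology.RightOreCondition C)

/-- A presheaf is a sheaf for the atomic topology iff every element that is compatible along a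
morphism descends uniquely along that morphism. -/
theorem isSheaf_atomic_iff (P : Cᵒᵖ ⥤ Type u) :
    Presheaf.IsSheaf (GrothendieckTopology.atomic ore) P ↔
      ∀ ⦃X Y : C⦄ (f : Y ⟶ X) (y : P.obj (op Y)),
        (∀ ⦃Z : C⦄ (p q : Z ⟶ Y), p ≫ f = q ≫ f → P.map p.op y = P.map q.op y) →
          ∃! x, P.map f.op x = y := by
  rw [isSheaf_iff_isSheaf_of_type]
  constructor
  · intro h X Y f y hy
    have h1 : (Presieve.singleton f).IsSheafFor P := by
      rw [Presieve.isSheafFor_iff_generate]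
      exact h _ ⟨Y, f, Y, 𝟙 Y, f, ⟨⟩, by simp⟩
    exact Presieve.isSheafFor_singleton.1 h1 y fun p q => hy p q
  · rintro h X S ⟨Y, f, hf⟩ x hx
    have hinj : ∀ ⦃X Y : C⦄ (f : Y ⟶ X), Function.Injective (P.map f.op) := by
      intro X Y f a b hab
      obtain ⟨c, -, hc⟩ := h f (P.map f.op a) fun Z p q hpq => by
        rw [← ConcreteCategory.comp_apply, ← ConcreteCategory.comp_apply, ← P.map_comp,
          ← P.map_comp, ← op_comp, ← op_comp, hpq]
      rw [hc a rfl, hc b hab.symm]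
    obtain ⟨z, hz, -⟩ := h f (x f hf) fun Z p q hpq => hx p q hf hf hpq
    refine ⟨z, fun W g hg => ?_, fun z' hz' => hinj f ((hz' f hf).trans hz.symm)⟩
    -- The glued element was built from `f` alone. Any other member `g` of the sieve is compared
    -- with `f` on an Ore square, along which restriction is injective.
    obtain ⟨V, p, q, hpq⟩ := ore f g
    apply hinj q
    have := hx p q hf hg hpq
    rw [← this, ← hz, ← ConcreteCategory.comp_apply, ← ConcreteCategory.comp_apply, ← P.map_comp,
      ← P.map_comp, ← op_comp, ← op_comp, hpq]

-- Every single morphism generates a covering sieve, so sheaves are separated along it.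
variable {ore} in
theorem map_injective_of_isSheaf_atomic {P : Cᵒᵖ ⥤ Type u}
    (h : Presheaf.IsSheaf (GrothendieckTopology.atomic ore) P) ⦃X Y : C⦄ (f : Y ⟶ X) :
    Function.Injective (P.map f.op) := by
  rw [isSheaf_atomic_iff] at h
  intro a b hab
  obtain ⟨c, -, hc⟩ := h f (P.map f.op a) fun Z p q hpq => by
    rw [← ConcreteCategory.comp_apply, ← ConcreteCategory.comp_apply, ← P.map_comp,
      ← P.map_comp, ← op_comp, ← op_comp, hpq]
  rw [hc a rfl, hc b hab.symm]

/-- Each morphism `f : Y ⟶ X` has a finite family of pairs of morphisms to `Y` that become equal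
over `X`, such that every such pair `(g, h)` is, after refinement, linked through a third morphism
`k` by members of the family. -/
def HasFiniteLinkingFamilies (C : Type u₁) [Category.{v₁} C] : Prop :=
  ∀ ⦃X Y : C⦄ (f : Y ⟶ X), ∃ (ι : Type v₁) (_ : Finite ι) (Z : ι → C) (a b : ∀ j, Z j ⟶ Y),
    (∀ j, a j ≫ f = b j ≫ f) ∧
      ∀ ⦃W : C⦄ (g h : W ⟶ Y), g ≫ f = h ≫ f → ∃ (W' : C) (m : W' ⟶ W) (k : W' ⟶ Y),
        (∃ (j : ι) (r : W' ⟶ Z j), r ≫ a j = m ≫ g ∧ r ≫ b j = k) ∧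
        (∃ (j : ι) (r : W' ⟶ Z j), r ≫ a j = m ≫ h ∧ r ≫ b j = k)

/-- Under the finiteness condition, a filtered colimit of sheaves for the atomic topology is a
sheaf. -/
theorem isSheaf_atomic_of_isColimit (hC : HasFiniteLinkingFamilies C)
    {J : Type u} [SmallCategory J] [IsFiltered J]
    (D : J ⥤ Sheaf (GrothendieckTopology.atomic ore) (Type u))
    (c : Cocone (D ⋙ sheafToPresheaf _ _)) (hc : IsColimit c) :
    Presheaf.IsSheaf (GrothendieckTopology.atomic ore) c.pt := by
  have hcX (X : C) := isColimitOfPreserves ((evaluation Cᵒᵖ (Type u)).obj (op X)) hc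
  have hrep (X : C) (y : c.pt.obj (op X)) : ∃ (j : J) (z : (D.obj j).obj.obj (op X)),
      (c.ι.app j).app (op X) z = y := Types.jointly_surjective_of_isColimit (hcX X) y
  have hnat {X Y : C} (f : Y ⟶ X) (j : J) (z : (D.obj j).obj.obj (op X)) :
      (c.ι.app j).app (op Y) ((D.obj j).obj.map f.op z) =
        c.pt.map f.op ((c.ι.app j).app (op X) z) :=
    ConcreteCategory.congr_hom ((c.ι.app j).naturality f.op) z
  have hnat' {X Y : C} (f : Y ⟶ X) {j k : J} (a : j ⟶ k) (z : (D.obj j).obj.obj (op X)) :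
      ((D.map a).hom.app (op Y)) ((D.obj j).obj.map f.op z) =
        (D.obj k).obj.map f.op ((D.map a).hom.app (op X) z) :=
    ConcreteCategory.congr_hom ((D.map a).hom.naturality f.op) z
  have hw {X : C} {j k : J} (a : j ⟶ k) (z : (D.obj j).obj.obj (op X)) :
      (c.ι.app k).app (op X) ((D.map a).hom.app (op X) z) = (c.ι.app j).app (op X) z :=
    ConcreteCategory.congr_hom (congr_app (c.w a) (op X)) z
  have heq {X : C} {j : J} (y z : (D.obj j).obj.obj (op X))
      (h : (c.ι.app j).app (op X) y = (c.ι.app j).app (op X) z) :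
      ∃ (k : J) (a : j ⟶ k), (D.map a).hom.app (op X) y = (D.map a).hom.app (op X) z := by
    obtain ⟨k, a, b, hab⟩ := (Types.FilteredColimit.isColimit_eq_iff _ (hcX X)).1 h
    refine ⟨IsFiltered.coeq a b, a ≫ IsFiltered.coeqHom a b, ?_⟩
    have h1 : ((D.map a).hom.app (op X) y) = ((D.map b).hom.app (op X) z) := hab
    conv_rhs => rw [IsFiltered.coeq_condition]
    simp only [Functor.map_comp, ObjectProperty.FullSubcategory.comp_hom, NatTrans.comp_app,
      ConcreteCategory.comp_apply, h1]
  rw [isSheaf_atomic_iff]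
  intro X Y f y hy
  refine existsUnique_of_exists_of_unique ?_ ?_
  · obtain ⟨ι, _, Z, a, b, hab, hlink⟩ := hC f
    obtain ⟨j, y, rfl⟩ := hrep Y y
    have h1 : ∀ i : ι, ∃ (k : J) (e : j ⟶ k),
        (D.obj k).obj.map (a i).op ((D.map e).hom.app (op Y) y) =
          (D.obj k).obj.map (b i).op ((D.map e).hom.app (op Y) y) := by
      intro i
      have h2 := hy (a i) (b i) (hab i)
      rw [← hnat, ← hnat] at h2
      obtain ⟨k, e, he⟩ := heq _ _ h2
      exact ⟨k, e, by rw [← hnat', ← hnat', he]⟩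
    -- Only here does finiteness of the linking family enter: finitely many equalities, each true at
    -- its own stage, hold together at one later stage.
    obtain ⟨k, e, hk⟩ : ∃ (k : J) (e : j ⟶ k), ∀ i : ι,
        (D.obj k).obj.map (a i).op ((D.map e).hom.app (op Y) y) =
          (D.obj k).obj.map (b i).op ((D.map e).hom.app (op Y) y) := by
      choose k e hk using h1
      obtain ⟨k', g, hg⟩ : ∃ (k' : J) (g : ∀ i, k i ⟶ k'),
          ∀ i i', e i ≫ g i = e i' ≫ g i' := by
        classical
        have := Fintype.ofFinite ι
        obtain ⟨k', t, ht⟩ := IsFiltered.sup_exists (insert j (Finset.univ.image k))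
          (Finset.univ.image fun i : ι =>
            (⟨j, k i, by simp, by simp, e i⟩ :
              Σ' (X Y : J) (_ : X ∈ insert j (Finset.univ.image k))
                (_ : Y ∈ insert j (Finset.univ.image k)), X ⟶ Y))
        refine ⟨k', fun i => t (by simp), fun i i' => ?_⟩
        have hti (i : ι) := ht (by simp) (by simp)
          (Finset.mem_image.2 ⟨i, Finset.mem_univ i, rfl⟩)
        exact (hti i).trans (hti i').symm
      by_cases hι : Nonempty ι
      · obtain ⟨i₀⟩ := hι
        refine ⟨k', e i₀ ≫ g i₀, fun i => ?_⟩
        rw [hg i₀ i]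
        simp only [Functor.map_comp, ObjectProperty.FullSubcategory.comp_hom, NatTrans.comp_app,
          ConcreteCategory.comp_apply]
        rw [← hnat' (a i) (g i), ← hnat' (b i) (g i), hk i]
      · exact ⟨j, 𝟙 j, fun i => (hι ⟨i⟩).elim⟩
    have hD := (isSheaf_atomic_iff ore _).1 (D.obj k).property
    -- For an arbitrary pair `(g, h)`, the restrictions along `m ≫ g` and `m ≫ h` both equal the one
    -- along the linking morphism `l`; then `m` is cancelled by injectivity.
    obtain ⟨x, hx, -⟩ := hD f ((D.map e).hom.app (op Y) y) fun W g h hgh => by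
      obtain ⟨W', m, l, ⟨i, r, hr, hr'⟩, ⟨i', s, hs, hs'⟩⟩ := hlink g h hgh
      apply map_injective_of_isSheaf_atomic (D.obj k).property m
      have h1 : ∀ {U V : C} (p : V ⟶ U) (q : U ⟶ Y) (z : (D.obj k).obj.obj (op Y)),
          (D.obj k).obj.map p.op ((D.obj k).obj.map q.op z) =
            (D.obj k).obj.map (p ≫ q).op z := by
        intro U V p q z
        rw [op_comp, Functor.map_comp, ConcreteCategory.comp_apply]
      rw [h1, h1, ← hr, ← hs, ← h1, ← h1, hk, hk, h1, h1, hr', hs']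
    refine ⟨(c.ι.app k).app (op X) x, ?_⟩
    rw [← hnat, hx, hw]
  · intro x x' hx hx'
    obtain ⟨j, x, rfl⟩ := hrep X x
    obtain ⟨j', x', rfl⟩ := hrep X x'
    rw [← hw (IsFiltered.leftToMax j j') x, ← hw (IsFiltered.rightToMax j j') x'] at *
    rw [← hx', ← hnat, ← hnat] at hx
    obtain ⟨k, e, he⟩ := heq _ _ hx
    rw [hnat', hnat'] at he
    rw [← hw e, map_injective_of_isSheaf_atomic (D.obj k).property f he, hw]

-- Sheaves are reflective in presheaves, and by `isSheaf_atomic_of_isColimit` the inclusion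
-- preserves filtered colimits; local finite presentability passes to such reflective subcategories.
attribute [local instance] Cardinal.fact_isRegular_aleph0 in
theorem isLocallyFinitelyPresentable_sheaf_atomic (hC : HasFiniteLinkingFamilies C) :
    IsLocallyFinitelyPresentable.{u} (Sheaf (GrothendieckTopology.atomic ore) (Type u)) := by
  have : (sheafToPresheaf (GrothendieckTopology.atomic ore) (Type u)).IsCardinalAccessible
      Cardinal.aleph0.{u} := by
    refine ⟨fun J _ _ => ?_⟩
    have : IsFiltered J := isFiltered_of_isCardinalFiltered J Cardinal.aleph0.{u}
    refine ⟨fun {D} => ?_⟩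
    have := Sheaf.createsColimitOfIsSheaf D fun c hc => isSheaf_atomic_of_isColimit ore hC D c hc
    infer_instance
  exact (sheafificationAdjunction (GrothendieckTopology.atomic ore)
    (Type u)).isCardinalLocallyPresentable Cardinal.aleph0.{u}

end AtomicSite

/-! ### Constant sheaves: connectedness and atomicity -/

section ConstantSheaves

variable {C : Type u} [SmallCategory C] (ore : GrothendieckTopology.RightOreCondition C)

/-- Constant presheaves are sheaves for the atomic topology. -/
theorem isSheaf_atomic_const (A : Type u) :
    Presheaf.IsSheaf (GrothendieckTopology.atomic ore) ((Functor.const Cᵒᵖ).obj A) := by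
  rw [isSheaf_atomic_iff]
  exact fun X Y f y _ => ⟨y, rfl, fun _ h => h⟩

/-- The functor sending a set to the constant sheaf for the atomic topology. -/
def atomicConst : Type u ⥤ Sheaf (GrothendieckTopology.atomic ore) (Type u) :=
  ObjectProperty.lift _ (Functor.const Cᵒᵖ) (isSheaf_atomic_const ore)

/-- Constant sheaves are left adjoint to evaluation at a terminal object. -/
noncomputable def atomicConstAdj {T : C} (hT : IsTerminal T) :
    atomicConst ore ⊣ sheafToPresheaf (GrothendieckTopology.atomic ore) (Type u) ⋙
      (evaluation Cᵒᵖ (Type u)).obj (op T) :=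
  (constantPresheafAdj (Type u) hT).restrictFullyFaithful (Functor.FullyFaithful.id _)
    (fullyFaithfulSheafToPresheaf _ _) (Iso.refl _) (Iso.refl _)

theorem preservesFiniteLimits_atomicConst : PreservesFiniteLimits (atomicConst ore) := by
  refine ⟨fun J _ _ => ?_⟩
  have : PreservesLimitsOfShape J (atomicConst ore ⋙ sheafToPresheaf _ _) :=
    inferInstanceAs (PreservesLimitsOfShape J (Functor.const Cᵒᵖ))
  exact preservesLimitsOfShape_of_reflects_of_preserves (atomicConst ore) (sheafToPresheaf _ _)

/-- The geometric morphism to the topos of sets, for a site with a terminal object. -/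
noncomputable def atomicGlobalSections {T : C} (hT : IsTerminal T) :
    GeometricMorphism (Sheaf (GrothendieckTopology.atomic ore) (Type u)) (Type u) where
  directImage := _
  inverseImage := atomicConst ore
  adj := atomicConstAdj ore hT
  preservesFiniteLimits := preservesFiniteLimits_atomicConst ore

/-- Naturality along the maps to the terminal object forces all components of a morphism of constant
sheaves to equal the one at `T`. -/
theorem isConnectedTopos_sheaf_atomic {T : C} (hT : IsTerminal T) :
    IsConnectedTopos (Sheaf (GrothendieckTopology.atomic ore) (Type u)) := by
  refine ⟨atomicGlobalSections ore hT, ⟨fun {A B} f => ⟨f.hom.app (op T), ?_⟩⟩,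
    ⟨fun {A B} f g hfg => ?_⟩⟩
  · apply Sheaf.hom_ext
    ext c : 2
    exact (Category.comp_id _).symm.trans ((f.hom.naturality (hT.from c.unop).op).symm.trans
      (Category.id_comp _))
  · exact congrArg (fun h : (atomicConst ore).obj A ⟶ (atomicConst ore).obj B =>
      h.hom.app (op T)) hfg

variable {ore} in
/-- A relation between sheaves is a relation at each object of the site. -/
theorem IsRelation.app {A B R : Sheaf (GrothendieckTopology.atomic ore) (Type u)}
    {a : R ⟶ A} {b : R ⟶ B} (h : IsRelation a b) (c : C) :
    IsRelation (a.hom.app (op c)) (b.hom.app (op c)) := by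
  have key : ∀ y z : R.obj.obj (op c), a.hom.app (op c) y = a.hom.app (op c) z →
      b.hom.app (op c) y = b.hom.app (op c) z → y = z := by
    intro y z ha hb
    -- An element of `R` at `c` is a map to `R` from the sheafified representable of `c`, so joint
    -- monicity in the category of sheaves can be tested on it.
    have hw : ∀ {D : Sheaf (GrothendieckTopology.atomic ore) (Type u)} (d : R ⟶ D),
        d.hom.app (op c) y = d.hom.app (op c) z →
        ((sheafificationAdjunction _ _).homEquiv _ _).symm (yonedaEquiv.symm y) ≫ d =
          ((sheafificationAdjunction _ _).homEquiv _ _).symm (yonedaEquiv.symm z) ≫ d := by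
      intro D d hd
      rw [← Adjunction.homEquiv_naturality_right_symm,
        ← Adjunction.homEquiv_naturality_right_symm]
      congr 1
      apply yonedaEquiv.injective
      rw [yonedaEquiv_comp, yonedaEquiv_comp, Equiv.apply_symm_apply, Equiv.apply_symm_apply]
      exact hd
    have := h _ _ (hw a ha) (hw b hb)
    exact yonedaEquiv.symm.injective (Equiv.injective _ this)
  intro T f g hf hg
  ext t
  exact key _ _ (ConcreteCategory.congr_hom hf t) (ConcreteCategory.congr_hom hg t)

/-- The inverse image functor of the geometric morphism to sets preserves power objects. -/
theorem isPowerObject_map_atomicConst {A P R : Type u} (a : R ⟶ A) (p : R ⟶ P)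
    (h : IsPowerObject a p) :
    IsPowerObject ((atomicConst ore).map a) ((atomicConst ore).map p) := by
  refine ⟨fun T f g hf hg => ?_, fun X S s x hs => ?_⟩
  · apply Sheaf.hom_ext
    ext c : 2
    exact h.isRelation _ _ (congrArg (fun k => k.hom.app c) hf) (congrArg (fun k => k.hom.app c) hg)
  have hs' (c : Cᵒᵖ) : IsRelation (s.hom.app c : S.obj.obj c ⟶ A) (x.hom.app c) := hs.app c.unop
  have hinj (c : Cᵒᵖ) (y z : S.obj.obj c) (h₁ : s.hom.app c y = s.hom.app c z)
      (h₂ : x.hom.app c y = x.hom.app c z) : y = z := by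
    have := hs' c (T := PUnit) (↾fun _ => y) (↾fun _ => z) (by ext; exact h₁) (by ext; exact h₂)
    exact ConcreteCategory.congr_hom this PUnit.unit
  have hsn {c d : Cᵒᵖ} (f : c ⟶ d) : S.obj.map f ≫ (s.hom.app d : S.obj.obj d ⟶ A) = s.hom.app c :=
    s.hom.naturality f
  -- An element of `S` descends as soon as its image in `X` does: compatibility can be checked in
  -- `A`, where it is automatic because `A` is constant, and in `X`, where it is the assumption.
  have hpb {c d : Cᵒᵖ} (f : c ⟶ d) :
      IsPullback (S.obj.map f) (x.hom.app c) (x.hom.app d) (X.obj.map f) := by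
    have hS := (isSheaf_atomic_iff ore _).1 S.property f.unop
    rw [Types.isPullback_iff]
    refine ⟨x.hom.naturality f, fun y z hyz =>
      map_injective_of_isSheaf_atomic S.property f.unop hyz.1, fun w v hwv => ?_⟩
    obtain ⟨y, hy, -⟩ := hS w fun Z p q hpq => by
      apply hinj
      · exact (ConcreteCategory.congr_hom (hsn p.op) w).trans
          (ConcreteCategory.congr_hom (hsn q.op) w).symm
      · refine (ConcreteCategory.congr_hom (x.hom.naturality p.op) w).trans
          (Eq.trans ?_ (ConcreteCategory.congr_hom (x.hom.naturality q.op) w).symm)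
        rw [ConcreteCategory.comp_apply, ConcreteCategory.comp_apply, hwv]
        have h1 : f ≫ p.op = f ≫ q.op := congrArg Quiver.Hom.op hpq
        rw [← ConcreteCategory.comp_apply, ← ConcreteCategory.comp_apply, ← X.obj.map_comp,
          ← X.obj.map_comp, h1]
    refine ⟨y, hy, map_injective_of_isSheaf_atomic X.property f.unop ?_⟩
    exact (ConcreteCategory.congr_hom (x.hom.naturality f) y).symm.trans
      ((congrArg (x.hom.app d) hy).trans hwv)
  choose χ ht hχ using fun c => h.existsUnique_classifying (s.hom.app c : S.obj.obj c ⟶ A)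
    (x.hom.app c) (hs' c)
  choose t ht₁ ht₂ using ht
  -- Pasting with `hpb` shows that the left side also classifies the relation at `c`; uniqueness
  -- turns the objectwise classifying maps into a natural one.
  have hχn {c d : Cᵒᵖ} (f : c ⟶ d) : X.obj.map f ≫ χ d = χ c :=
    hχ c _ ⟨S.obj.map f ≫ t d, by rw [Category.assoc, ht₁]; exact hsn f,
      (hpb f).paste_horiz (ht₂ d)⟩
  have htn {c d : Cᵒᵖ} (f : c ⟶ d) : S.obj.map f ≫ t d = t c := by
    apply h.isRelation
    · rw [Category.assoc, ht₁, ht₁]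
      exact hsn f
    · rw [Category.assoc, (ht₂ d).w, (ht₂ c).w, ← hχn f, ← Category.assoc, ← Category.assoc,
        x.hom.naturality]
  let χ' : X ⟶ (atomicConst ore).obj P :=
    ⟨{ app := χ, naturality := fun c d f => (hχn f).trans (Category.comp_id _).symm }⟩
  let t' : S ⟶ (atomicConst ore).obj R :=
    ⟨{ app := t, naturality := fun c d f => (htn f).trans (Category.comp_id _).symm }⟩
  refine ⟨χ', ⟨t', ?_, ?_⟩, ?_⟩
  · apply Sheaf.hom_ext
    ext c : 2
    exact ht₁ c
  · apply IsPullback.of_map (sheafToPresheaf _ _)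
    · apply Sheaf.hom_ext
      ext c : 2
      exact (ht₂ c).w
    · exact IsPullback.of_forall_isPullback_app fun c => ht₂ c
  · rintro ψ ⟨r, hr, hr'⟩
    apply Sheaf.hom_ext
    ext c : 2
    exact hχ c _ ⟨r.hom.app c, congrArg (fun k => k.hom.app c) hr,
      (hr'.map (sheafToPresheaf _ _)).map ((evaluation _ _).obj c)⟩

theorem isAtomicTopos_sheaf_atomic {T : C} (hT : IsTerminal T) :
    IsAtomicTopos (Sheaf (GrothendieckTopology.atomic ore) (Type u)) :=
  ⟨atomicGlobalSections ore hT, preservesFiniteLimits_atomicConst ore,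
    fun _ _ _ a p => isPowerObject_map_atomicConst ore a p⟩

/-- A topos of sheaves for an atomic topology without points does not have enough points, provided
that the site is nonempty. -/
theorem not_hasEnoughToposPoints_of_isEmpty [Nonempty C]
    (h : IsEmpty (ToposPoint (Sheaf (GrothendieckTopology.atomic ore) (Type u)))) :
    ¬ HasEnoughToposPoints (Sheaf (GrothendieckTopology.atomic ore) (Type u)) := by
  intro hE
  obtain ⟨c⟩ := ‹Nonempty C›
  -- Without points the test for isomorphisms is vacuous, so even the map of constant sheaves from
  -- two elements to one would be invertible.
  let f : (atomicConst ore).obj (ULift.{u} Bool) ⟶ (atomicConst ore).obj PUnit :=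
    (atomicConst ore).map (↾fun _ => PUnit.unit)
  have hf : IsIso f := hE f fun p => (h.false p).elim
  have h1 : IsIso (((sheafToPresheaf _ _) ⋙ (evaluation Cᵒᵖ (Type u)).obj (op c)).map f) :=
    inferInstance
  have h2 := ((isIso_iff_bijective _).1 h1).1 (a₁ := (⟨true⟩ : ULift.{u} Bool))
    (a₂ := (⟨false⟩ : ULift.{u} Bool)) rfl
  simpa using congrArg ULift.down h2

end ConstantSheaves

/-! ### Points and flat functors -/

section Points

variable {C : Type u} [SmallCategory C]

/-- If `L` preserves colimits, every element of `L P` comes from a representable over `P`. -/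
theorem exists_yoneda_map_eq (L : (Cᵒᵖ ⥤ Type u) ⥤ Type u) [PreservesColimitsOfSize.{u, u} L]
    (P : Cᵒᵖ ⥤ Type u) (x : L.obj P) :
    ∃ (W : C) (q : yoneda.obj W ⟶ P) (w : L.obj (yoneda.obj W)), L.map q w = x := by
  obtain ⟨j, w, hw⟩ := Types.jointly_surjective_of_isColimit
    (isColimitOfPreserves L (Presheaf.isColimitTautologicalCocone P)) x
  exact ⟨j.left, j.hom, w, hw⟩

/-- The restriction to representables of a functor that preserves finite limits and colimits is
flat. -/
theorem isCofiltered_elements_yoneda_comp (L : (Cᵒᵖ ⥤ Type u) ⥤ Type u)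
    [PreservesColimitsOfSize.{u, u} L] [PreservesFiniteLimits L] :
    IsCofiltered (yoneda ⋙ L).Elements := by
  have h1 : Nonempty (yoneda ⋙ L).Elements := by
    have hT := IsTerminal.isTerminalObj L _ (terminalIsTerminal (C := Cᵒᵖ ⥤ Type u))
    obtain ⟨W, -, w, -⟩ := exists_yoneda_map_eq L _ (hT.from PUnit PUnit.unit)
    exact ⟨⟨W, w⟩⟩
  refine { cone_objs := ?_, cone_maps := ?_ }
  · rintro ⟨A, s⟩ ⟨B, t⟩
    -- The pair `(s, t)` is an element of `L` at the product of the representables. It comes from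
    -- some representable `W`, which is the required common refinement. Equalizers replace products
    -- in the parallel case.
    have hl := mapIsLimitOfPreservesOfIsLimit L _ _ (prodIsProd (yoneda.obj A) (yoneda.obj B))
    obtain ⟨l, hl₁, hl₂⟩ := BinaryFan.IsLimit.lift' hl (W := PUnit) (↾fun _ => s) (↾fun _ => t)
    obtain ⟨W, q, w, hw⟩ := exists_yoneda_map_eq L _ (l PUnit.unit)
    have hs := ConcreteCategory.congr_hom hl₁ PUnit.unit
    have ht := ConcreteCategory.congr_hom hl₂ PUnit.unit
    refine ⟨⟨W, w⟩, ⟨yoneda.preimage (q ≫ prod.fst), ?_⟩,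
      ⟨yoneda.preimage (q ≫ prod.snd), ?_⟩, trivial⟩
    · refine Eq.trans ?_ hs
      refine Eq.trans ?_ (congrArg (L.map (prod.fst : yoneda.obj A ⨯ yoneda.obj B ⟶ _)) hw)
      rw [← ConcreteCategory.comp_apply, ← L.map_comp]
      exact congrArg (fun k => L.map k w) (yoneda.map_preimage _)
    · refine Eq.trans ?_ ht
      refine Eq.trans ?_ (congrArg (L.map (prod.snd : yoneda.obj A ⨯ yoneda.obj B ⟶ _)) hw)
      rw [← ConcreteCategory.comp_apply, ← L.map_comp]
      exact congrArg (fun k => L.map k w) (yoneda.map_preimage _)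
  · rintro ⟨A, s⟩ ⟨B, t⟩ ⟨f, hf⟩ ⟨g, hg⟩
    have hl := isLimitForkMapOfIsLimit L _ (equalizerIsEqualizer (yoneda.map f) (yoneda.map g))
    obtain ⟨l, hl₁⟩ := Fork.IsLimit.lift' hl (W := PUnit) (↾fun _ => s) (by
      ext
      exact hf.trans hg.symm)
    obtain ⟨W, q, w, hw⟩ := exists_yoneda_map_eq L _ (l PUnit.unit)
    have hs := ConcreteCategory.congr_hom hl₁ PUnit.unit
    refine ⟨⟨W, w⟩, ⟨yoneda.preimage (q ≫ equalizer.ι _ _), ?_⟩, ?_⟩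
    · refine Eq.trans ?_ hs
      refine Eq.trans ?_ (congrArg (L.map (equalizer.ι (yoneda.map f) (yoneda.map g))) hw)
      rw [← ConcreteCategory.comp_apply, ← L.map_comp]
      exact congrArg (fun k => L.map k w) (yoneda.map_preimage _)
    · ext
      apply yoneda.map_injective
      change yoneda.map (yoneda.preimage _ ≫ f) = yoneda.map (yoneda.preimage _ ≫ g)
      rw [Functor.map_comp, Functor.map_comp, yoneda.map_preimage, Category.assoc, Category.assoc,
        equalizer.condition]

variable (ore : GrothendieckTopology.RightOreCondition C)

/-- Sheafification for the atomic topology sends every morphism of representables to an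
epimorphism. -/
theorem epi_presheafToSheaf_map_yoneda_map {X Y : C} (f : Y ⟶ X) :
    Epi ((presheafToSheaf (GrothendieckTopology.atomic ore) (Type u)).map (yoneda.map f)) := by
  refine ⟨fun {G} a b hab => ?_⟩
  apply ((sheafificationAdjunction
    (GrothendieckTopology.atomic ore) (Type u)).homEquiv _ _).injective
  apply yonedaEquiv.injective
  apply map_injective_of_isSheaf_atomic G.property f
  have h := congrArg ((sheafificationAdjunction
    (GrothendieckTopology.atomic ore) (Type u)).homEquiv _ _) hab
  rw [Adjunction.homEquiv_naturality_left, Adjunction.homEquiv_naturality_left] at h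
  have h' := congrArg yonedaEquiv h
  rw [← yonedaEquiv_naturality, ← yonedaEquiv_naturality] at h'
  exact h'

/-- A point of the topos of sheaves for the atomic topology on a site with a terminal object gives
a flat functor with nonempty values. -/
theorem ToposPoint.exists_isCofiltered_elements {T : C} (hT : IsTerminal T)
    (p : ToposPoint (Sheaf (GrothendieckTopology.atomic ore) (Type u))) :
    ∃ F : C ⥤ Type u, IsCofiltered F.Elements ∧ ∀ X, Nonempty (F.obj X) := by
  have : p.inverseImage.IsLeftAdjoint := p.adj.isLeftAdjoint
  have := p.preservesFiniteLimits
  let L := presheafToSheaf (GrothendieckTopology.atomic ore) (Type u) ⋙ p.inverseImage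
  have hL := isCofiltered_elements_yoneda_comp L
  refine ⟨yoneda ⋙ L, hL, fun X => ?_⟩
  obtain ⟨A, a⟩ := hL.nonempty.some
  -- An element over `A` lifts along the cover `f : W ⟶ A` and is then pushed to `X` along `g`.
  obtain ⟨W, f, g, -⟩ := ore (hT.from A) (hT.from X)
  have := epi_presheafToSheaf_map_yoneda_map ore f
  have hf : Epi (L.map (yoneda.map f)) := inferInstanceAs (Epi (p.inverseImage.map _))
  obtain ⟨w, -⟩ := (epi_iff_surjective _).1 hf a
  exact ⟨(yoneda ⋙ L).map g w⟩

end Points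

/-! ### Counting branches along a flat functor -/

/-- The counting principle: a flat functor with a family of elements indexed by `I`, to which
sequences of `nodes` are attached that can be separated after refinement, while for each `n` the
`n`-th nodes take boundedly many values after each refinement. -/
theorem mk_le_continuum_of_isCofiltered_elements {C : Type u₁} [Category.{v₁} C]
    (F : C ⥤ Type u) [IsCofiltered F.Elements] (N : Cᵒᵖ ⥤ Type u₂) {I : Type u}
    (B : I → C) (s : ∀ i, F.obj (B i)) (β : ∀ i, ℕ → N.obj (op (B i)))
    (hN : ∀ ⦃X Y : C⦄ (f : X ⟶ Y), Function.Injective (N.map f.op))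
    (hfin : ∀ n, ∃ k : ℕ, ∀ (W : C) (i : Fin k → I) (a : ∀ m, W ⟶ B (i m)),
      ∃ m m', m ≠ m' ∧ N.map (a m).op (β (i m) n) = N.map (a m').op (β (i m') n))
    (hsep : ∀ (i j : I) (W : C) (a : W ⟶ B i) (b : W ⟶ B j),
      (∀ n, N.map a.op (β i n) = N.map b.op (β j n)) → i = j) :
    Cardinal.mk I ≤ Cardinal.continuum := by
  classical
  let p (i : I) : F.Elements := ⟨B i, s i⟩
  have hcomp {e e' : F.Elements} {i : I} (c : e' ⟶ e) (a : e ⟶ p i) (n : ℕ) :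
      N.map (c ≫ a).1.op (β i n) = N.map c.1.op (N.map a.1.op (β i n)) := by
    rw [CategoryOfElements.comp_val, op_comp, Functor.map_comp, ConcreteCategory.comp_apply]
  -- Equality of the `n`-th nodes in the virtual union: they coincide after some refinement.
  -- Cofilteredness gives transitivity.
  let r (n : ℕ) : Setoid I :=
    { r := fun i j => ∃ (e : F.Elements) (a : e ⟶ p i) (b : e ⟶ p j),
        N.map a.1.op (β i n) = N.map b.1.op (β j n)
      iseqv :=
        { refl := fun i => ⟨p i, 𝟙 _, 𝟙 _, rfl⟩
          symm := fun ⟨e, a, b, h⟩ => ⟨e, b, a, h.symm⟩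
          trans := by
            rintro i j k ⟨e, a, b, h⟩ ⟨e', b', c, h'⟩
            obtain ⟨W, g, g', hg⟩ := IsCofiltered.cospan b b'
            refine ⟨W, g ≫ a, g' ≫ c, ?_⟩
            rw [hcomp, hcomp, h, ← h', ← hcomp, ← hcomp, hg] } }
  -- Given `k` pairwise inequivalent indices, a common refinement would identify two of their nodes
  -- by `hfin`.
  have hq (n : ℕ) : Finite (Quotient (r n)) := by
    by_contra hinf
    rw [not_finite_iff_infinite] at hinf
    obtain ⟨k, hk⟩ := hfin n
    let i (m : Fin k) : I := (Infinite.natEmbedding (Quotient (r n)) m).out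
    obtain ⟨e, he⟩ := IsCofiltered.inf_objs_exists (Finset.univ.image fun m => p (i m))
    have he' (m : Fin k) : Nonempty (e ⟶ p (i m)) :=
      he (Finset.mem_image_of_mem _ (Finset.mem_univ m))
    obtain ⟨m, m', hne, hmm⟩ := hk e.1 i fun m => ((he' m).some).1
    have h1 : (Quotient.mk (r n) (i m)) = Quotient.mk (r n) (i m') :=
      Quotient.sound ⟨e, _, _, hmm⟩
    rw [Quotient.out_eq, Quotient.out_eq] at h1
    exact hne (Fin.ext ((Infinite.natEmbedding _).injective h1))
  choose g hg using fun n => exists_injective_nat (Quotient (r n))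
  have hinj : Function.Injective fun (i : I) (n : ℕ) => g n (Quotient.mk (r n) i) := by
    intro i j hij
    have h1 (n : ℕ) : ∃ (e : F.Elements) (a : e ⟶ p i) (b : e ⟶ p j),
        N.map a.1.op (β i n) = N.map b.1.op (β j n) :=
      Quotient.exact (hg n (congrFun hij n))
    -- The refinement in `h1` varies with `n`, but `hsep` needs a fixed one. Each equality is moved
    -- to a refinement of `e` and then brought back to `e` by injectivity of `N`.
    let e := IsCofiltered.min (p i) (p j)
    refine hsep i j e.1 (IsCofiltered.minToLeft (p i) (p j)).1
      (IsCofiltered.minToRight (p i) (p j)).1 fun n => ?_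
    obtain ⟨e', a, b, hab⟩ := h1 n
    obtain ⟨W, c, c', hc⟩ := IsCofiltered.cospan a (IsCofiltered.minToLeft (p i) (p j))
    let d := IsCofiltered.eqHom (c ≫ b) (c' ≫ IsCofiltered.minToRight (p i) (p j))
    have hd : d ≫ c ≫ b = d ≫ c' ≫ IsCofiltered.minToRight (p i) (p j) :=
      IsCofiltered.eq_condition _ _
    apply hN (d ≫ c').1
    rw [← hcomp, ← hcomp, Category.assoc, Category.assoc, ← hd, ← hc, ← Category.assoc,
      ← Category.assoc, hcomp, hcomp, hab]
  have h2 := Cardinal.lift_mk_le_lift_mk_of_injective hinj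
  simpa using h2

/-! ### Paths, parents and depth in full binary trees -/

namespace FullBinaryTree

section Paths

variable {N : Type u} {r : N} {R : N → N → Prop}

theorem isChain_append_singleton {l : List N} {y : N} (hl : List.IsChain R (r :: l))
    (hy : R ((r :: l).getLast (List.cons_ne_nil r l)) y) :
    List.IsChain R (r :: (l ++ [y])) ∧
      (r :: (l ++ [y])).getLast (List.cons_ne_nil _ _) = y := by
  refine ⟨?_, by simp⟩
  rw [← List.cons_append, List.isChain_append]
  refine ⟨hl, by simp, ?_⟩
  intro a ha b hb
  rw [List.getLast?_eq_some_getLast (List.cons_ne_nil r l), Option.mem_some_iff] at ha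
  obtain rfl : y = b := by simpa using hb
  exact ha ▸ hy

theorem rel_getLast_of_isChain_append {l : List N} {y : N}
    (hl : List.IsChain R (r :: (l ++ [y]))) :
    List.IsChain R (r :: l) ∧ R ((r :: l).getLast (List.cons_ne_nil r l)) y := by
  rw [← List.cons_append, List.isChain_append] at hl
  exact ⟨hl.1, hl.2.2 _ (List.getLast?_eq_some_getLast _) y (by simp)⟩

/-- In a graph where parents are unique and the root has no parent, a node has at most one path from
the root. -/
theorem path_unique (h₀ : ∀ x, ¬ R x r) (h₁ : ∀ x x' y, R x y → R x' y → x = x') (l : List N) :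
    ∀ l' : List N, List.IsChain R (r :: l) → List.IsChain R (r :: l') →
      (r :: l).getLast (List.cons_ne_nil r l) = (r :: l').getLast (List.cons_ne_nil r l') →
      l = l' := by
  induction l using List.reverseRecOn with
  | nil =>
    intro l' _ hl' h
    rcases List.eq_nil_or_concat' l' with rfl | ⟨m, z, rfl⟩
    · rfl
    · have := (rel_getLast_of_isChain_append hl').2
      simp only [List.getLast_singleton] at h
      rw [show (r :: (m ++ [z])).getLast (List.cons_ne_nil _ _) = z by simp] at h
      rw [← h] at this
      exact (h₀ _ this).elim
  | append_singleton m z ih =>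
    intro l' hl hl' h
    have hm := rel_getLast_of_isChain_append hl
    rw [show (r :: (m ++ [z])).getLast (List.cons_ne_nil _ _) = z by simp] at h
    rcases List.eq_nil_or_concat' l' with rfl | ⟨m', z', rfl⟩
    · simp only [List.getLast_singleton] at h
      exact (h₀ _ (h ▸ hm.2)).elim
    · have hm' := rel_getLast_of_isChain_append hl'
      rw [show (r :: (m' ++ [z'])).getLast (List.cons_ne_nil _ _) = z' by simp] at h
      subst h
      rw [ih m' hm.1 hm'.1 (h₁ _ _ _ hm.2 hm'.2)]

end Paths

section Basic

variable {X Y : FullBinaryTree.{u}}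

theorem induction {P : X.Node → Prop} (root : P X.root)
    (child : ∀ x y, X.Child x y → P x → P y) (x : X.Node) : P x := by
  have hpath : ∀ (l : List X.Node) (x : X.Node), P x → List.IsChain X.Child (x :: l) →
      P ((x :: l).getLast (List.cons_ne_nil x l)) := by
    intro l
    induction l with
    | nil => intro x hx _; simpa using hx
    | cons y l ih =>
      intro x hx hc
      rw [List.isChain_cons_cons] at hc
      rw [List.getLast_cons (List.cons_ne_nil y l)]
      exact ih y (child x y hc.1 hx) hc.2
  obtain ⟨l, ⟨hl, rfl⟩, -⟩ := X.existsUnique_path x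
  exact hpath l _ root hl

/-- The path from the root to a node. -/
noncomputable def path (x : X.Node) : List X.Node := (X.existsUnique_path x).choose

theorem path_eq {x : X.Node} {l : List X.Node} (hl : List.IsChain X.Child (X.root :: l))
    (hx : (X.root :: l).getLast (List.cons_ne_nil X.root l) = x) : path x = l :=
  ((X.existsUnique_path x).choose_spec.2 l ⟨hl, hx⟩).symm

theorem path_root : path X.root = [] := path_eq (by simp) (by simp)

theorem path_child {x y : X.Node} (h : X.Child x y) : path y = path x ++ [y] := by
  have hx := (X.existsUnique_path x).choose_spec.1
  have h1 := isChain_append_singleton (y := y) hx.1 (by rw [hx.2]; exact h)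
  exact path_eq h1.1 h1.2

theorem not_child_root (x : X.Node) : ¬ X.Child x X.root := by
  intro h
  simpa [path_root] using path_child h

theorem parent_unique {x x' y : X.Node} (h : X.Child x y) (h' : X.Child x' y) : x = x' := by
  have h1 := (path_child h).symm.trans (path_child h')
  have h2 : path x = path x' := List.append_cancel_right h1
  have hx := (X.existsUnique_path x).choose_spec.1.2
  have hx' := (X.existsUnique_path x').choose_spec.1.2
  rw [← hx, ← hx']
  change (X.root :: path x).getLast _ = (X.root :: path x').getLast _
  simp only [h2]

theorem eq_root_or_exists_child (y : X.Node) : y = X.root ∨ ∃ x, X.Child x y :=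
  induction (P := fun y => y = X.root ∨ ∃ x, X.Child x y) (Or.inl rfl)
    (fun x _ h _ => Or.inr ⟨x, h⟩) y

/-- The distance of a node from the root. -/
noncomputable def depth (x : X.Node) : ℕ := (path x).length

theorem depth_root : depth X.root = 0 := by simp [depth, path_root]

theorem depth_child {x y : X.Node} (h : X.Child x y) : depth y = depth x + 1 := by
  simp [depth, path_child h]

theorem depth_branch (b : X.Branch) (n : ℕ) : depth (b.1 n) = n := by
  induction n with
  | zero => rw [b.2.1, depth_root]
  | succ n ih => rw [depth_child (b.2.2 n), ih]

theorem exists_sibling {x y : X.Node} (h : X.Child x y) : ∃ z, X.Child x z ∧ z ≠ y := by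
  rcases X.children x with h' | h'
  · exact (Set.eq_empty_iff_forall_notMem.1 h' y h).elim
  · obtain ⟨a, b, hab, h'⟩ := Set.ncard_eq_two.1 h'
    have hmem (z : X.Node) : X.Child x z ↔ z = a ∨ z = b := by
      simpa using Set.ext_iff.1 h' z
    rcases (hmem y).1 h with rfl | rfl
    · exact ⟨b, (hmem b).2 (Or.inr rfl), hab.symm⟩
    · exact ⟨a, (hmem a).2 (Or.inl rfl), hab⟩

/-- A node has at most two children. -/
theorem child_eq_or_eq {x y z w : X.Node} (hy : X.Child x y) (hz : X.Child x z) (hyz : y ≠ z)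
    (hw : X.Child x w) : w = y ∨ w = z := by
  rcases X.children x with h' | h'
  · exact (Set.eq_empty_iff_forall_notMem.1 h' y hy).elim
  · obtain ⟨a, b, hab, h'⟩ := Set.ncard_eq_two.1 h'
    have hmem (z : X.Node) : X.Child x z ↔ z = a ∨ z = b := by
      simpa using Set.ext_iff.1 h' z
    rw [hmem] at hy hz hw
    grind

theorem Embedding.depth_apply (f : Embedding X Y) (x : X.Node) : depth (f.toFun x) = depth x := by
  induction x using induction with
  | root => rw [f.map_root, depth_root, depth_root]
  | child x y h ih => rw [depth_child ((f.map_child x y).2 h), depth_child h, ih]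

theorem Embedding.exists_parent (f : Embedding X Y) {u : Y.Node} {x : X.Node}
    (h : Y.Child u (f.toFun x)) : ∃ x', X.Child x' x ∧ f.toFun x' = u := by
  rcases eq_root_or_exists_child x with rfl | ⟨x', hx'⟩
  · rw [f.map_root] at h
    exact (not_child_root _ h).elim
  · exact ⟨x', hx', parent_unique ((f.map_child x' x).2 hx') h⟩

/-- If one child of a node is in the range of an embedding, then so is the other one. -/
theorem Embedding.exists_of_sibling (f : Embedding X Y) {u v : Y.Node} {x : X.Node}
    (h : Y.Child u (f.toFun x)) (hv : Y.Child u v) : ∃ x', f.toFun x' = v := by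
  obtain ⟨x₀, hx₀, rfl⟩ := f.exists_parent h
  obtain ⟨z, hz, hzx⟩ := exists_sibling hx₀
  rcases child_eq_or_eq h ((f.map_child x₀ z).2 hz) (fun h' => hzx (f.injective h'.symm)) hv with
    rfl | rfl
  · exact ⟨_, rfl⟩
  · exact ⟨_, rfl⟩

theorem Embedding.mem_range_of_le (f : Embedding X Y) (b : Y.Branch) {m n : ℕ} (hmn : m ≤ n)
    (h : ∃ x, f.toFun x = b.1 n) : ∃ x, f.toFun x = b.1 m := by
  induction n, hmn using Nat.le_induction with
  | base => exact h
  | succ n _ ih =>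
    obtain ⟨x, hx⟩ := h
    obtain ⟨x', -, hx'⟩ := f.exists_parent (x := x) (hx ▸ b.2.2 n)
    exact ih ⟨x', hx'⟩

theorem Embedding.exists_mapBranch_eq (f : Embedding X Y) (b : Y.Branch)
    (h : ∀ n, ∃ x, f.toFun x = b.1 n) : ∃ a : X.Branch, f.mapBranch a = b := by
  choose a ha using h
  refine ⟨⟨a, f.injective ?_, fun n => ?_⟩, Subtype.ext (funext ha)⟩
  · rw [ha, b.2.1, f.map_root]
  · rw [← f.map_child, ha, ha]
    exact b.2.2 n

theorem Embedding.mapBranch_injective (f : Embedding X Y) : Function.Injective f.mapBranch := by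
  intro a b h
  exact Subtype.ext (funext fun n => f.injective (congrFun (congrArg Subtype.val h) n))

end Basic

/-! ### Codings of trees by finite binary sequences -/

/-- A coding of a full binary tree is an embedding into the complete binary tree, whose nodes are
the finite binary sequences, written from the last entry to the first one. -/
structure IsCoding {X : FullBinaryTree.{u}} (φ : X.Node → List Bool) : Prop where
  root : φ X.root = []
  child : ∀ x y, X.Child x y → ∃ b, φ y = b :: φ x
  injective : Function.Injective φ

section Coding

variable {X Y : FullBinaryTree.{u}}

/-- A function that separates siblings induces a coding. -/
theorem exists_isCoding_of_side (σ : X.Node → Bool)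
    (hσ : ∀ x y z, X.Child x y → X.Child x z → σ y = σ z → y = z) :
    ∃ φ : X.Node → List Bool, IsCoding φ ∧ ∀ x y, X.Child x y → φ y = σ y :: φ x := by
  have hc : ∀ x y, X.Child x y → (path y).reverse.map σ = σ y :: (path x).reverse.map σ := by
    intro x y h
    simp [path_child h]
  refine ⟨fun x => (path x).reverse.map σ, ⟨by simp [path_root], fun x y h => ⟨_, hc x y h⟩, ?_⟩,
    hc⟩
  intro x
  induction x using induction with
  | root =>
    intro y hy
    rcases eq_root_or_exists_child y with rfl | ⟨y', hy'⟩
    · rfl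
    · simp only [hc _ _ hy', path_root] at hy
      simp at hy
  | child x₀ x hx ih =>
    intro y hy
    rcases eq_root_or_exists_child y with rfl | ⟨y₀, hy₀⟩
    · simp only [hc _ _ hx, path_root] at hy
      simp at hy
    · simp only [hc _ _ hx, hc _ _ hy₀, List.cons.injEq] at hy
      obtain rfl := ih hy.2
      exact hσ x₀ x y hx hy₀ hy.1

/-- Mark one chosen child of each inner node; since parents are unique, the mark of a node does not
depend on anything else. -/
theorem exists_side (X : FullBinaryTree.{u}) : ∃ σ : X.Node → Bool,
    ∀ x y z, X.Child x y → X.Child x z → σ y = σ z → y = z := by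
  classical
  let first (x : X.Node) : X.Node := if h : ∃ y, X.Child x y then h.choose else x
  refine ⟨fun y => decide (∃ x, X.Child x y ∧ y = first x), fun x y z hy hz hyz => ?_⟩
  have hf : X.Child x (first x) := by
    have h : ∃ y, X.Child x y := ⟨y, hy⟩
    simp only [first, dif_pos h]
    exact h.choose_spec
  have key : ∀ w, X.Child x w → ((∃ x', X.Child x' w ∧ w = first x') ↔ w = first x) := by
    intro w hw
    constructor
    · rintro ⟨x', hx', h⟩
      rwa [parent_unique hw hx']
    · intro h
      exact ⟨x, hw, h⟩
  rw [decide_eq_decide, key y hy, key z hz] at hyz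
  by_contra hne
  rcases child_eq_or_eq hy hz hne hf with h | h <;> grind

theorem exists_isCoding (X : FullBinaryTree.{u}) : ∃ φ : X.Node → List Bool, IsCoding φ := by
  obtain ⟨σ, hσ⟩ := exists_side X
  obtain ⟨φ, hφ, -⟩ := exists_isCoding_of_side σ hσ
  exact ⟨φ, hφ⟩

theorem IsCoding.comp {φ : Y.Node → List Bool} (hφ : IsCoding φ) (f : Embedding X Y) :
    IsCoding fun x => φ (f.toFun x) where
  root := by rw [f.map_root, hφ.root]
  child x y h := hφ.child _ _ ((f.map_child x y).2 h)
  injective := hφ.injective.comp f.injective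

theorem IsCoding.length {φ : X.Node → List Bool} (hφ : IsCoding φ) (x : X.Node) :
    (φ x).length = depth x := by
  induction x using induction with
  | root => rw [hφ.root, depth_root, List.length_nil]
  | child x y h ih =>
    obtain ⟨b, hb⟩ := hφ.child x y h
    rw [hb, List.length_cons, ih, depth_child h]

theorem IsCoding.exists_parent {φ : X.Node → List Bool} (hφ : IsCoding φ) {y : X.Node} {b : Bool}
    {l : List Bool} (h : φ y = b :: l) : ∃ x, X.Child x y ∧ φ x = l := by
  rcases eq_root_or_exists_child y with rfl | ⟨x, hx⟩
  · rw [hφ.root] at h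
    simp at h
  · obtain ⟨b', hb'⟩ := hφ.child x y hx
    rw [h, List.cons.injEq] at hb'
    exact ⟨x, hx, hb'.2.symm⟩

theorem IsCoding.child_iff {φ : X.Node → List Bool} (hφ : IsCoding φ) (x y : X.Node) :
    X.Child x y ↔ ∃ b, φ y = b :: φ x := by
  refine ⟨hφ.child x y, fun ⟨b, hb⟩ => ?_⟩
  obtain ⟨x', hx', h⟩ := hφ.exists_parent hb
  rwa [← hφ.injective h]

theorem IsCoding.exists_sibling {φ : X.Node → List Bool} (hφ : IsCoding φ) {y : X.Node} {b : Bool}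
    {l : List Bool} (h : φ y = b :: l) : ∃ z, φ z = (!b) :: l := by
  obtain ⟨x, hx, rfl⟩ := hφ.exists_parent h
  obtain ⟨z, hz, hzy⟩ := FullBinaryTree.exists_sibling hx
  obtain ⟨b', hb'⟩ := hφ.child x z hz
  refine ⟨z, ?_⟩
  rw [hb']
  congr 1
  by_contra hne
  have : b' = b := by cases b <;> cases b' <;> simp_all
  exact hzy (hφ.injective (by rw [hb', h, this]))

theorem IsCoding.branch_succ {φ : X.Node → List Bool} (hφ : IsCoding φ) (b : X.Branch) (n : ℕ) :
    ∃ a, φ (b.1 (n + 1)) = a :: φ (b.1 n) :=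
  hφ.child _ _ (b.2.2 n)

/-- The codes of the ancestors of a node are the tails of its code. The two branches may belong to
different trees. -/
theorem IsCoding.branch_eq_of_le {φ : X.Node → List Bool} {ψ : Y.Node → List Bool}
    (hφ : IsCoding φ) (hψ : IsCoding ψ) (b : X.Branch) (c : Y.Branch) {m n : ℕ} (hmn : m ≤ n)
    (h : φ (b.1 n) = ψ (c.1 n)) : φ (b.1 m) = ψ (c.1 m) := by
  induction n, hmn using Nat.le_induction with
  | base => exact h
  | succ n _ ih =>
    obtain ⟨a, ha⟩ := hφ.branch_succ b n
    obtain ⟨a', ha'⟩ := hψ.branch_succ c n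
    rw [ha, ha', List.cons.injEq] at h
    exact ih h.2

/-- A coding of a subtree extends to a coding of the whole tree. Outside of the subtree it can be
twisted, at each depth, by an arbitrary binary sequence. -/
theorem Embedding.exists_isCoding_twist (f : Embedding X Y) {θ : X.Node → List Bool}
    (hθ : IsCoding θ) : ∃ s : Y.Node → Bool, ∀ t : ℕ → Bool, ∃ ψ : Y.Node → List Bool,
      IsCoding ψ ∧ (∀ x, ψ (f.toFun x) = θ x) ∧
        ∀ u v, Y.Child u v → (¬ ∃ x, f.toFun x = v) →
          ψ v = (xor (s v) (t (depth u))) :: ψ u := by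
  classical
  obtain ⟨s, hs⟩ := exists_side Y
  refine ⟨s, fun t => ?_⟩
  -- Siblings lie both inside or both outside the subtree, so the two cases never conflict. Outside,
  -- both siblings receive the same twist, which keeps them apart; `depth v - 1` is the depth of the
  -- parent.
  let σ (v : Y.Node) : Bool :=
    if h : ∃ x, f.toFun x = v then (θ h.choose).headI else xor (s v) (t (depth v - 1))
  have hσ₁ (x : X.Node) : σ (f.toFun x) = (θ x).headI := by
    have h : ∃ x', f.toFun x' = f.toFun x := ⟨x, rfl⟩
    simp only [σ, dif_pos h]
    rw [f.injective h.choose_spec]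
  have hσ₂ (v : Y.Node) (h : ¬ ∃ x, f.toFun x = v) : σ v = xor (s v) (t (depth v - 1)) := by
    simp only [σ, dif_neg h]
  obtain ⟨ψ, hψ, hψσ⟩ := exists_isCoding_of_side σ (by
    intro u v w hv hw hvw
    by_cases h : ∃ x, f.toFun x = v
    · obtain ⟨x, rfl⟩ := h
      obtain ⟨z, rfl⟩ := f.exists_of_sibling hv hw
      obtain ⟨x₀, hx₀, rfl⟩ := f.exists_parent hv
      rw [f.map_child] at hw
      obtain ⟨b, hb⟩ := hθ.child _ _ hx₀
      obtain ⟨b', hb'⟩ := hθ.child _ _ hw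
      rw [hσ₁, hσ₁, hb, hb'] at hvw
      rw [hθ.injective (a₁ := x) (a₂ := z) (by rw [hb, hb']; simpa using hvw)]
    · have h' : ¬ ∃ x, f.toFun x = w := by
        rintro ⟨x, rfl⟩
        exact h (f.exists_of_sibling hw hv)
      rw [hσ₂ v h, hσ₂ w h', depth_child hv, depth_child hw] at hvw
      exact hs u v w hv hw (by simpa using hvw))
  refine ⟨ψ, hψ, fun x => ?_, fun u v huv hv => ?_⟩
  · induction x using induction with
    | root => rw [f.map_root, hψ.root, hθ.root]
    | child x y h ih =>
      rw [hψσ _ _ ((f.map_child x y).2 h), ih, hσ₁]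
      obtain ⟨b, hb⟩ := hθ.child _ _ h
      rw [hb, List.headI_cons]
  · rw [hψσ u v huv, hσ₂ v hv, depth_child huv, Nat.add_sub_cancel]

end Coding

/-! ### Trees of finite binary sequences -/

/-- The full binary tree given by a set of finite binary sequences. -/
def ofSet (S : Set (List Bool)) (h₀ : [] ∈ S) (h₁ : ∀ b l, b :: l ∈ S → l ∈ S)
    (h₂ : ∀ b l, b :: l ∈ S → (!b) :: l ∈ S) : FullBinaryTree.{u} where
  Node := ULift.{u} S
  root := ⟨⟨[], h₀⟩⟩
  Child x y := ∃ b, y.down.1 = b :: x.down.1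
  children x := by
    by_cases h : ∃ b, b :: x.down.1 ∈ S
    · right
      have hb : ∀ b, b :: x.down.1 ∈ S := by
        intro b
        obtain ⟨b', hb'⟩ := h
        by_cases hbb : b = b'
        · exact hbb ▸ hb'
        · have : b = !b' := by cases b <;> cases b' <;> simp_all
          exact this ▸ h₂ b' _ hb'
      rw [Set.ncard_eq_two]
      refine ⟨⟨⟨_, hb true⟩⟩, ⟨⟨_, hb false⟩⟩, by simp, ?_⟩
      ext ⟨⟨y, hy⟩⟩
      simp [or_comm]
    · left
      ext ⟨⟨y, hy⟩⟩
      simp only [Set.mem_ofPred_eq, Set.mem_empty_iff_false, iff_false]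
      rintro ⟨b, rfl⟩
      exact h ⟨b, hy⟩
  existsUnique_path y := by
    refine existsUnique_of_exists_of_unique ?_ ?_
    · obtain ⟨⟨y, hy⟩⟩ := y
      induction y with
      | nil => exact ⟨[], by simp⟩
      | cons b l ih =>
        obtain ⟨m, hm, hm'⟩ := ih (h₁ b l hy)
        exact ⟨_, isChain_append_singleton (y := (⟨⟨b :: l, hy⟩⟩ : ULift.{u} S)) hm
          ⟨b, by rw [hm']⟩⟩
    · rintro l l' ⟨hl, h⟩ ⟨hl', h'⟩
      refine path_unique ?_ ?_ l l' hl hl' (h.trans h'.symm)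
      · rintro x ⟨b, hb⟩
        simp at hb
      · rintro x x' z ⟨b, hb⟩ ⟨b', hb'⟩
        rw [hb, List.cons.injEq] at hb'
        exact ULift.ext _ _ (Subtype.ext hb'.2)

theorem ofSet_isCoding (S : Set (List Bool)) (h₀ : [] ∈ S) (h₁ : ∀ b l, b :: l ∈ S → l ∈ S)
    (h₂ : ∀ b l, b :: l ∈ S → (!b) :: l ∈ S) :
    IsCoding (X := ofSet.{u} S h₀ h₁ h₂) fun x => x.down.1 where
  root := rfl
  child _ _ h := h
  injective _ _ h := ULift.ext _ _ (Subtype.ext h)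

end FullBinaryTree

/-! ### Generic amalgamation and finite linking families -/

/-- A binary sequence that differs from each member of a finite family inside a window whose length
is the size of the family, and infinitely often from each member of a countable family. -/
theorem exists_seq_ne {ι κ : Type*} [Finite ι] [Countable κ] (d : ι → ℕ → Bool)
    (d' : κ → ℕ → Bool) (N : ℕ) : ∃ t : ℕ → Bool,
      (∀ i, ∃ m, N ≤ m ∧ m < N + Nat.card ι ∧ t m ≠ d i m) ∧
        ∀ k n, ∃ m, n ≤ m ∧ t m ≠ d' k m := by
  obtain ⟨e, he⟩ := exists_injective_nat κ
  let E := Finite.equivFin ι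
  -- Inside the window each position opposes one member of the finite family. Outside it, position
  -- `m` opposes the member of the countable family coded by the first component of `m.unpair`, so
  -- each member is met infinitely often.
  let t (m : ℕ) : Bool :=
    if h : N ≤ m ∧ m - N < Nat.card ι then !(d (E.symm ⟨m - N, h.2⟩) m)
    else !(Function.extend e d' (fun _ _ => false) m.unpair.1 m)
  refine ⟨t, fun i => ?_, fun k n => ?_⟩
  · have hi := (E i).isLt
    refine ⟨N + E i, by omega, by omega, ?_⟩
    have h : N ≤ N + (E i : ℕ) ∧ N + (E i : ℕ) - N < Nat.card ι := by omega
    have h1 : (⟨N + (E i : ℕ) - N, h.2⟩ : Fin (Nat.card ι)) = E i := Fin.ext (by simp)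
    simp only [t, dif_pos h, h1, Equiv.symm_apply_apply]
    simp
  · have hle : n + N + Nat.card ι ≤ Nat.pair (e k) (n + N + Nat.card ι) := Nat.right_le_pair _ _
    refine ⟨Nat.pair (e k) (n + N + Nat.card ι), by omega, ?_⟩
    have h : ¬ (N ≤ Nat.pair (e k) (n + N + Nat.card ι) ∧
        Nat.pair (e k) (n + N + Nat.card ι) - N < Nat.card ι) := by omega
    simp only [t, dif_neg h, Nat.unpair_pair, he.extend_apply]
    simp

namespace LabeledTree

open FullBinaryTree

variable {I : Type u} {X Y Z U W : LabeledTree I}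

/-- Two codings with compatible labels can be glued to an amalgam, the union of their ranges. -/
theorem exists_amalgam {φ : X.Node → List Bool} {ψ : Y.Node → List Bool}
    (hφ : IsCoding (X := X.toFullBinaryTree) φ) (hψ : IsCoding (X := Y.toFullBinaryTree) ψ)
    (hl : ∀ (b : X.Branch) (c : Y.Branch), (∀ n, φ (b.1 n) = ψ (c.1 n)) → X.label b = Y.label c) :
    ∃ (U : LabeledTree I) (a : Hom X U) (b : Hom Y U),
      (∀ u, (∃ x, a.toFun x = u) ∨ ∃ y, b.toFun y = u) ∧
        ∀ x y, a.toFun x = b.toFun y ↔ φ x = ψ y := by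
  classical
  let T : FullBinaryTree.{u} := ofSet (Set.range φ ∪ Set.range ψ) (Or.inl ⟨_, hφ.root⟩)
    (by
      rintro b l (⟨x, hx⟩ | ⟨y, hy⟩)
      · obtain ⟨x', -, h⟩ := hφ.exists_parent hx
        exact Or.inl ⟨x', h⟩
      · obtain ⟨y', -, h⟩ := hψ.exists_parent hy
        exact Or.inr ⟨y', h⟩)
    (by
      rintro b l (⟨x, hx⟩ | ⟨y, hy⟩)
      · exact Or.inl (hφ.exists_sibling hx)
      · exact Or.inr (hψ.exists_sibling hy))
  let α (x : X.Node) : T.Node := ⟨⟨φ x, Or.inl ⟨x, rfl⟩⟩⟩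
  let γ (y : Y.Node) : T.Node := ⟨⟨ψ y, Or.inr ⟨y, rfl⟩⟩⟩
  have hαγ (x : X.Node) (y : Y.Node) : α x = γ y ↔ φ x = ψ y :=
    ⟨fun h => congrArg (fun u : T.Node => u.down.1) h, fun h => ULift.ext _ _ (Subtype.ext h)⟩
  let a : Embedding X.toFullBinaryTree T :=
    { toFun := α
      injective := fun x x' h => hφ.injective (congrArg (fun u : T.Node => u.down.1) h)
      map_root := ULift.ext _ _ (Subtype.ext hφ.root)
      map_child := fun x y => (hφ.child_iff x y).symm }
  let b : Embedding Y.toFullBinaryTree T :=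
    { toFun := γ
      injective := fun x x' h => hψ.injective (congrArg (fun u : T.Node => u.down.1) h)
      map_root := ULift.ext _ _ (Subtype.ext hψ.root)
      map_child := fun x y => (hψ.child_iff x y).symm }
  -- A branch coming from both trees takes its label from `X`; `hab` shows that `Y` gives the same
  -- one.
  let lab (c : T.Branch) : Option I :=
    if h : ∃ c', a.mapBranch c' = c then X.label h.choose
    else if h : ∃ c', b.mapBranch c' = c then Y.label h.choose else none
  have hab (c : X.Branch) (c' : Y.Branch) (h : a.mapBranch c = b.mapBranch c') :
      X.label c = Y.label c' :=
    hl c c' fun n => (hαγ _ _).1 (congrFun (congrArg Subtype.val h) n)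
  refine ⟨{ toFullBinaryTree := T, label := lab },
    { toEmbedding := a, map_label := ?_ }, { toEmbedding := b, map_label := ?_ }, ?_, hαγ⟩
  · intro c i hc
    have h : ∃ c', a.mapBranch c' = a.mapBranch c := ⟨c, rfl⟩
    simp only [lab, dif_pos h]
    rw [a.mapBranch_injective h.choose_spec, hc]
  · intro c i hc
    by_cases h : ∃ c', a.mapBranch c' = b.mapBranch c
    · simp only [lab, dif_pos h]
      rw [hab _ _ h.choose_spec, hc]
    · have h' : ∃ c', b.mapBranch c' = b.mapBranch c := ⟨c, rfl⟩
      simp only [lab, dif_neg h, dif_pos h']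
      rw [b.mapBranch_injective h'.choose_spec, hc]
  · rintro ⟨⟨u, ⟨x, rfl⟩ | ⟨y, rfl⟩⟩⟩
    · exact Or.inl ⟨x, rfl⟩
    · exact Or.inr ⟨y, rfl⟩

/-- A branch of a union of two subtrees is a branch of one of them. -/
theorem branch_cases (a : Embedding X.toFullBinaryTree U.toFullBinaryTree)
    (b : Embedding Y.toFullBinaryTree U.toFullBinaryTree)
    (hs : ∀ u, (∃ x, a.toFun x = u) ∨ ∃ y, b.toFun y = u) (c : U.Branch) :
    (∃ c', a.mapBranch c' = c) ∨ ∃ c', b.mapBranch c' = c := by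
  by_cases h : ∀ n, ∃ x, a.toFun x = c.1 n
  · exact Or.inl (a.exists_mapBranch_eq c h)
  · right
    -- Ranges of embeddings are closed under parents, so a branch that has left the range of `a`
    -- never returns to it. Its deep nodes lie in the range of `b`, hence so do all of its nodes.
    push Not at h
    obtain ⟨m, hm⟩ := h
    refine b.exists_mapBranch_eq c fun n => ?_
    refine b.mem_range_of_le c (le_max_right m n) ((hs _).resolve_left fun h' => ?_)
    obtain ⟨x, hx⟩ := a.mem_range_of_le c (le_max_left m n) h'
    exact hm x hx

theorem IsFinitary.of_jointlySurjective (hX : X.IsFinitary) (hY : Y.IsFinitary) (a : Hom X U)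
    (b : Hom Y U) (hs : ∀ u, (∃ x, a.toFun x = u) ∨ ∃ y, b.toFun y = u) : U.IsFinitary where
  finite_branch := by
    have := hX.finite_branch
    have := hY.finite_branch
    refine Finite.of_surjective
      (Sum.elim a.toEmbedding.mapBranch b.toEmbedding.mapBranch) fun c => ?_
    rcases branch_cases a.toEmbedding b.toEmbedding hs c with ⟨c', h⟩ | ⟨c', h⟩
    · exact ⟨Sum.inl c', h⟩
    · exact ⟨Sum.inr c', h⟩
  finite_off_branch := by
    refine ((hX.finite_off_branch.image a.toFun).union
      (hY.finite_off_branch.image b.toFun)).subset ?_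
    rintro u ⟨v, hvu, hv⟩
    rcases hs u with ⟨x, rfl⟩ | ⟨y, rfl⟩
    · obtain ⟨x', hx', rfl⟩ := a.toEmbedding.exists_parent hvu
      exact Or.inl ⟨x, ⟨x', hx', fun c n h => hv (a.toEmbedding.mapBranch c) n
        (congrArg a.toFun h)⟩, rfl⟩
    · obtain ⟨y', hy', rfl⟩ := b.toEmbedding.exists_parent hvu
      exact Or.inr ⟨y, ⟨y', hy', fun c n h => hv (b.toEmbedding.mapBranch c) n
        (congrArg b.toFun h)⟩, rfl⟩
  label_isSome c := by
    rcases branch_cases a.toEmbedding b.toEmbedding hs c with ⟨c', rfl⟩ | ⟨c', rfl⟩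
    · obtain ⟨i, hi⟩ := Option.isSome_iff_exists.1 (hX.label_isSome c')
      rw [a.map_label c' i hi, Option.isSome_some]
    · obtain ⟨i, hi⟩ := Option.isSome_iff_exists.1 (hY.label_isSome c')
      rw [b.map_label c' i hi, Option.isSome_some]

theorem IsFinitary.label_mapBranch (hX : X.IsFinitary) (a : Hom X U) (c : X.Branch) :
    U.label (a.toEmbedding.mapBranch c) = X.label c := by
  obtain ⟨i, hi⟩ := Option.isSome_iff_exists.1 (hX.label_isSome c)
  rw [hi, a.map_label c i hi]

/-- The universal property of a union of two subtrees. -/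
theorem IsFinitary.exists_desc (hX : X.IsFinitary) (hY : Y.IsFinitary) (a : Hom X U) (b : Hom Y U)
    (hs : ∀ u, (∃ x, a.toFun x = u) ∨ ∃ y, b.toFun y = u) (g : Hom X W) (h : Hom Y W)
    (hgh : ∀ x y, g.toFun x = h.toFun y ↔ a.toFun x = b.toFun y) :
    ∃ r : Hom U W, (∀ x, r.toFun (a.toFun x) = g.toFun x) ∧
      ∀ y, r.toFun (b.toFun y) = h.toFun y := by
  have hr : ∀ u, ∃ w, (∀ x, a.toFun x = u → g.toFun x = w) ∧
      ∀ y, b.toFun y = u → h.toFun y = w := by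
    intro u
    rcases hs u with ⟨x, rfl⟩ | ⟨y, rfl⟩
    · exact ⟨g.toFun x, fun x' h' => congrArg g.toFun (a.injective h'),
        fun y h' => ((hgh x y).2 h'.symm).symm⟩
    · exact ⟨h.toFun y, fun x h' => (hgh x y).2 h',
        fun y' h' => congrArg h.toFun (b.injective h')⟩
  choose r hra hrb using hr
  have hra' (x : X.Node) : r (a.toFun x) = g.toFun x := (hra _ x rfl).symm
  have hrb' (y : Y.Node) : r (b.toFun y) = h.toFun y := (hrb _ y rfl).symm
  let e : Embedding U.toFullBinaryTree W.toFullBinaryTree :=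
    { toFun := r
      injective := by
        intro u v huv
        rcases hs u with ⟨x, rfl⟩ | ⟨y, rfl⟩ <;> rcases hs v with ⟨x', rfl⟩ | ⟨y', rfl⟩
        · rw [hra', hra'] at huv
          rw [g.injective huv]
        · rw [hra', hrb'] at huv
          exact (hgh _ _).1 huv
        · rw [hrb', hra'] at huv
          exact ((hgh _ _).1 huv.symm).symm
        · rw [hrb', hrb'] at huv
          rw [h.injective huv]
      map_root := by rw [← a.map_root, hra', g.map_root]
      map_child := by
        intro u v
        rcases hs u with ⟨x, rfl⟩ | ⟨y, rfl⟩ <;> rcases hs v with ⟨x', rfl⟩ | ⟨y', rfl⟩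
        · rw [hra', hra', g.map_child, a.map_child]
        · rw [hra', hrb']
          constructor
          · intro hc
            obtain ⟨z, hz, h'⟩ := h.toEmbedding.exists_parent hc
            rw [(hgh x z).1 h'.symm]
            exact (b.map_child _ _).2 hz
          · intro hc
            obtain ⟨z, hz, h'⟩ := b.toEmbedding.exists_parent hc
            rw [(hgh x z).2 h'.symm]
            exact (h.map_child _ _).2 hz
        · rw [hra', hrb']
          constructor
          · intro hc
            obtain ⟨z, hz, h'⟩ := g.toEmbedding.exists_parent hc
            rw [← (hgh z y).1 h']
            exact (a.map_child _ _).2 hz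
          · intro hc
            obtain ⟨z, hz, h'⟩ := a.toEmbedding.exists_parent hc
            rw [← (hgh z y).2 h']
            exact (g.map_child _ _).2 hz
        · rw [hrb', hrb', h.map_child, b.map_child] }
  refine ⟨{ toEmbedding := e, map_label := ?_ }, hra', hrb'⟩
  intro c i hc
  rcases branch_cases a.toEmbedding b.toEmbedding hs c with ⟨c', rfl⟩ | ⟨c', rfl⟩
  · rw [hX.label_mapBranch a] at hc
    rw [← g.map_label c' i hc]
    exact congrArg W.label (Subtype.ext (funext fun n => hra' _))
  · rw [hY.label_mapBranch b] at hc
    rw [← h.map_label c' i hc]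
    exact congrArg W.label (Subtype.ext (funext fun n => hrb' _))

/-- The union of the ranges of two embeddings of a finitary tree, as a finitary tree. -/
theorem IsFinitary.exists_union_range (hY : Y.IsFinitary) (g h : Hom Y W) :
    ∃ (U : LabeledTree I) (a b : Hom Y U),
      (∀ u, (∃ x, a.toFun x = u) ∨ ∃ y, b.toFun y = u) ∧
        ∀ x y, a.toFun x = b.toFun y ↔ g.toFun x = h.toFun y := by
  -- Restricting one coding of `W` along both `g` and `h` makes the gluing identify exactly the
  -- nodes with equal images in `W`.
  obtain ⟨ζ, hζ⟩ := exists_isCoding W.toFullBinaryTree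
  obtain ⟨U, a, b, hs, hab⟩ := exists_amalgam (hζ.comp g.toEmbedding) (hζ.comp h.toEmbedding)
    fun c c' hc => by
      rw [← hY.label_mapBranch g, ← hY.label_mapBranch h]
      exact congrArg W.label (Subtype.ext (funext fun n => hζ.injective (hc n)))
  exact ⟨U, a, b, hs, fun x y => (hab x y).trans hζ.injective.eq_iff⟩

/-- Amalgamation of finitary trees. The amalgam can be chosen such that the branches of `Y` outside
of `X` are separated, at a uniform depth, from a given finite family of branches of `Z`. -/
theorem IsFinitary.exists_separated_amalgam (hX : X.IsFinitary) (hY : Y.IsFinitary)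
    (hZ : Z.IsFinitary) (f : Hom X Y) (g : Hom X Z) {N : ℕ}
    (hN : ∀ c : Y.Branch, (∃ x, f.toFun x = c.1 N) → ∀ n, ∃ x, f.toFun x = c.1 n)
    {ι : Type*} [Finite ι] (β : ι → Z.Branch) :
    ∃ (U : LabeledTree I) (a : Hom Z U) (b : Hom Y U), U.IsFinitary ∧
      (∀ x, a.toFun (g.toFun x) = b.toFun (f.toFun x)) ∧
        ∀ (i : ι) (c : Y.Branch), a.toFun ((β i).1 (N + Nat.card (ι × Y.Branch))) =
          b.toFun (c.1 (N + Nat.card (ι × Y.Branch))) → ∀ n, ∃ x, f.toFun x = c.1 n := by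
  have := hY.finite_branch
  have := hZ.finite_branch
  obtain ⟨ζ, hζ⟩ := exists_isCoding Z.toFullBinaryTree
  obtain ⟨s, hs⟩ := f.toEmbedding.exists_isCoding_twist (hζ.comp g.toEmbedding)
  -- The only value of `t m` for which `b` can still agree with `c` at depth `m + 1` when `c` is
  -- outside `X` there.
  let D (b : Z.Branch) (c : Y.Branch) (m : ℕ) : Bool :=
    xor (ζ (b.1 (m + 1))).headI (s (c.1 (m + 1)))
  -- The window separates the prescribed branches at a uniform depth. Disagreement with all pairs
  -- infinitely often ensures that a branch of `Y` outside `X` is never glued to a branch of `Z`, so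
  -- labels cannot clash.
  obtain ⟨t, ht₁, ht₂⟩ := exists_seq_ne (fun p : ι × Y.Branch => D (β p.1) p.2)
    (fun p : Z.Branch × Y.Branch => D p.1 p.2) N
  obtain ⟨ψ, hψ, hψf, hψt⟩ := hs t
  have hD (b : Z.Branch) (c : Y.Branch) (m : ℕ) (hc : ¬ ∃ x, f.toFun x = c.1 (m + 1))
      (h : ζ (b.1 (m + 1)) = ψ (c.1 (m + 1))) : t m = D b c m := by
    simp only [D]
    rw [h, hψt _ _ (c.2.2 m) hc, depth_branch c, List.headI_cons]
    cases t m <;> cases s (c.1 (m + 1)) <;> rfl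
  obtain ⟨U, a, b, hsurj, hab⟩ := exists_amalgam hζ hψ (by
    intro c c' hc
    by_cases h : ∀ n, ∃ x, f.toFun x = c'.1 n
    · obtain ⟨d, rfl⟩ := f.toEmbedding.exists_mapBranch_eq c' h
      have hd : g.toEmbedding.mapBranch d = c := Subtype.ext (funext fun n =>
        hζ.injective ((hc n).trans (hψf (d.1 n))).symm)
      rw [← hd, hX.label_mapBranch, hX.label_mapBranch]
    · rw [not_forall] at h
      obtain ⟨n, hn⟩ := h
      obtain ⟨m, hm, hne⟩ := ht₂ (c, c') n
      exact (hne (hD c c' m (fun h' => hn (f.toEmbedding.mem_range_of_le c' (by omega) h'))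
        (hc _))).elim)
  refine ⟨U, a, b, hZ.of_jointlySurjective hY a b hsurj, fun x => (hab _ _).2 (hψf x).symm, ?_⟩
  intro i c hic
  by_contra h
  obtain ⟨m, hm₁, hm₂, hne⟩ := ht₁ (i, c)
  refine hne (hD _ _ m (fun h' => h (hN c (f.toEmbedding.mem_range_of_le c (by omega) h'))) ?_)
  exact hζ.branch_eq_of_le hψ (β i) c (by omega) ((hab _ _).1 hic)

theorem finite_setOf_depth_le (Y : LabeledTree I) (M : ℕ) : {y : Y.Node | depth y ≤ M}.Finite := by
  obtain ⟨φ, hφ⟩ := exists_isCoding Y.toFullBinaryTree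
  refine Set.Finite.of_finite_image ((List.finite_length_le Bool M).subset ?_) hφ.injective.injOn
  rintro _ ⟨y, hy, rfl⟩
  exact (hφ.length y).trans_le hy

/-- For large `N`, nodes of depth larger than `N` have their parent on a branch, different
branches are separated at depth `N`, and the branches outside of a subtree have left it at
depth `N`. -/
theorem IsFinitary.exists_depth (hY : Y.IsFinitary) (f : Hom X Y) : ∃ N : ℕ,
    (∀ x y, Y.Child x y → N < depth y → ∃ b : Y.Branch, b.1 (depth x) = x) ∧
    (∀ b c : Y.Branch, b.1 N = c.1 N → b = c) ∧
      ∀ c : Y.Branch, (∃ x, f.toFun x = c.1 N) → ∀ n, ∃ x, f.toFun x = c.1 n := by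
  have := hY.finite_branch
  obtain ⟨φ, hφ⟩ := exists_isCoding Y.toFullBinaryTree
  have h₁ : ∀ᶠ N in Filter.atTop, ∀ b c : Y.Branch, b.1 N = c.1 N → b = c := by
    rw [Filter.eventually_all]
    intro b
    rw [Filter.eventually_all]
    intro c
    by_cases hbc : b = c
    · exact Filter.Eventually.of_forall fun _ _ => hbc
    · obtain ⟨n, hn⟩ : ∃ n, b.1 n ≠ c.1 n := by
        by_contra! h
        exact hbc (Subtype.ext (funext h))
      filter_upwards [Filter.eventually_ge_atTop n] with N hN h
      exact (hn (hφ.injective (hφ.branch_eq_of_le hφ b c hN (congrArg φ h)))).elim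
  have h₂ : ∀ᶠ N in Filter.atTop, ∀ c : Y.Branch, (∃ x, f.toFun x = c.1 N) →
      ∀ n, ∃ x, f.toFun x = c.1 n := by
    rw [Filter.eventually_all]
    intro c
    by_cases h : ∀ n, ∃ x, f.toFun x = c.1 n
    · exact Filter.Eventually.of_forall fun _ _ => h
    · rw [not_forall] at h
      obtain ⟨n, hn⟩ := h
      filter_upwards [Filter.eventually_ge_atTop n] with N hN h
      exact (hn (f.toEmbedding.mem_range_of_le c hN h)).elim
  have h₃ : ∀ᶠ N in Filter.atTop, ∀ x y, Y.Child x y → N < depth y →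
      ∃ b : Y.Branch, b.1 (depth x) = x := by
    obtain ⟨N₀, hN₀⟩ := (hY.finite_off_branch.image depth).bddAbove
    filter_upwards [Filter.eventually_ge_atTop N₀] with N hN x y hxy hy
    by_contra! h
    have : depth y ≤ N₀ := hN₀ ⟨y, ⟨x, hxy, fun b n hb => h b (by rw [← hb, depth_branch b])⟩, rfl⟩
    omega
  exact (h₃.and (h₁.and h₂)).exists

/-- Each embedding `f` of finitary trees admits a finite linking family. -/
theorem IsFinitary.exists_finite_linking (hX : X.IsFinitary) (hY : Y.IsFinitary) (f : Hom X Y) :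
    ∃ (ι : Type u) (_ : Finite ι) (Z : ι → LabeledTree I) (a b : ∀ j, Hom Y (Z j)),
      (∀ j, (Z j).IsFinitary) ∧ (∀ j x, (a j).toFun (f.toFun x) = (b j).toFun (f.toFun x)) ∧
      ∀ (W : LabeledTree I) (_ : W.IsFinitary) (g h : Hom Y W),
        (∀ x, g.toFun (f.toFun x) = h.toFun (f.toFun x)) →
        ∃ (W' : LabeledTree I) (_ : W'.IsFinitary) (m : Hom W W') (k : Hom Y W'),
          (∃ (j : ι) (r : Hom (Z j) W'), (∀ y, r.toFun ((a j).toFun y) = m.toFun (g.toFun y)) ∧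
            ∀ y, r.toFun ((b j).toFun y) = k.toFun y) ∧
          (∃ (j : ι) (r : Hom (Z j) W'), (∀ y, r.toFun ((a j).toFun y) = m.toFun (h.toFun y)) ∧
            ∀ y, r.toFun ((b j).toFun y) = k.toFun y) := by
  have := hY.finite_branch
  obtain ⟨N, hN₁, hN₂, hN₃⟩ := hY.exists_depth f
  -- The depth given by `exists_separated_amalgam` for the images of the branches of `Y` under two
  -- embeddings, told apart by the `Bool`. It does not depend on `W`, `g` or `h`.
  let M := N + Nat.card ((Y.Branch × Bool) × Y.Branch)
  let IsSep {W : LabeledTree I} (g h : Hom Y W) : Prop :=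
    (∀ x, g.toFun (f.toFun x) = h.toFun (f.toFun x)) ∧
      ∀ b c : Y.Branch, g.toFun (b.1 M) = h.toFun (c.1 M) → ∀ n, ∃ x, f.toFun x = c.1 n
  let Rel {W : LabeledTree I} (g h : Hom Y W) : Set (Y.Node × Y.Node) :=
    {p | g.toFun p.1 = h.toFun p.2}
  let 𝓡 : Set (Set (Y.Node × Y.Node)) :=
    {R | ∃ (W : LabeledTree I) (g h : Hom Y W), IsSep g h ∧ Rel g h = R}
  -- The parents of `y` and `y'` lie on branches `b` and `c` whose images agree down to depth `M`.
  -- Separation puts `c` in `X`, where `g` and `h` coincide, so `b = c` by agreement at depth `N`.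
  -- Then `y` and `y'` are children of one node of `c`, hence in `X`.
  have hdeep {W : LabeledTree I} {g h : Hom Y W} (hgh : IsSep g h) {y y' : Y.Node}
      (hyy : g.toFun y = h.toFun y') (hy : M < depth y) : y = y' ∧ ∃ x, f.toFun x = y := by
    have hd : depth y = depth y' := by
      rw [← g.toEmbedding.depth_apply y, ← h.toEmbedding.depth_apply y', hyy]
    obtain ⟨p, hp⟩ : ∃ p, Y.Child p y := by
      rcases eq_root_or_exists_child y with rfl | h'
      · rw [depth_root] at hy
        omega
      · exact h'
    obtain ⟨p', hp'⟩ : ∃ p', Y.Child p' y' := by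
      rcases eq_root_or_exists_child y' with rfl | h'
      · rw [hd, depth_root] at hy
        omega
      · exact h'
    have hpp : g.toFun p = h.toFun p' := by
      refine parent_unique ((g.map_child _ _).2 hp) ?_
      rw [hyy]
      exact (h.map_child _ _).2 hp'
    have hdp := depth_child hp
    have hdp' := depth_child hp'
    obtain ⟨b, hb⟩ := hN₁ p y hp (by omega)
    obtain ⟨c, hc⟩ := hN₁ p' y' hp' (by omega)
    have hdpp : depth p' = depth p := by omega
    rw [hdpp] at hc
    obtain ⟨ω, hω⟩ := exists_isCoding W.toFullBinaryTree
    have hle {n : ℕ} (hn : n ≤ depth p) : g.toFun (b.1 n) = h.toFun (c.1 n) := by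
      refine hω.injective ((hω.comp g.toEmbedding).branch_eq_of_le (hω.comp h.toEmbedding)
        b c hn ?_)
      rw [hb, hc]
      exact congrArg ω hpp
    have hcX := hgh.2 b c (hle (by omega))
    have hbc : b = c := by
      apply hN₂
      apply g.injective
      obtain ⟨x, hx⟩ := hcX N
      rw [hle (by omega), ← hx, hgh.1]
    have hpp' : p' = p := by rw [← hb, ← hc, hbc]
    subst hpp'
    obtain ⟨x, hx⟩ := hcX (depth p' + 1)
    have hcx : Y.Child p' (f.toFun x) := by
      have := c.2.2 (depth p')
      rwa [hc, ← hx] at this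
    obtain ⟨z, rfl⟩ := f.toEmbedding.exists_of_sibling hcx hp
    obtain ⟨z', rfl⟩ := f.toEmbedding.exists_of_sibling hcx hp'
    refine ⟨g.injective (hyy.trans (hgh.1 z').symm), z, rfl⟩
  -- By `hdeep`, a pattern is determined by its trace on the finitely many nodes of depth at most
  -- `M`.
  have hfin : 𝓡.Finite := by
    have hF := finite_setOf_depth_le Y M
    refine Set.Finite.of_finite_image (f := fun R => R ∩ ({y | depth y ≤ M} ×ˢ {y | depth y ≤ M}))
      ((hF.prod hF).finite_subsets.subset ?_) ?_
    · rintro _ ⟨R, -, rfl⟩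
      exact Set.inter_subset_right
    · have key : ∀ R ∈ 𝓡, ∀ R' ∈ 𝓡, R ∩ ({y | depth y ≤ M} ×ˢ {y | depth y ≤ M}) =
          R' ∩ ({y | depth y ≤ M} ×ˢ {y | depth y ≤ M}) → R ⊆ R' := by
        rintro _ ⟨W, g, h, hgh, rfl⟩ _ ⟨W', g', h', hgh', rfl⟩ heq ⟨y, y'⟩ hy
        change g.toFun y = h.toFun y' at hy
        by_cases hM : depth y ≤ M
        · have hd : depth y' ≤ M := by
            rwa [← h.toEmbedding.depth_apply y', ← hy, g.toEmbedding.depth_apply y]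
          have hmem : (y, y') ∈ Rel g h ∩ ({y | depth y ≤ M} ×ˢ {y | depth y ≤ M}) := ⟨hy, hM, hd⟩
          exact (heq.subset hmem).1
        · obtain ⟨rfl, x, rfl⟩ := hdeep hgh hy (by omega)
          exact hgh'.1 x
      intro R hR R' hR' heq
      exact (key R hR R' hR' heq).antisymm (key R' hR' R hR heq.symm)
  have hrep : ∀ R : 𝓡, ∃ (U : LabeledTree I) (a b : Hom Y U),
      (∀ u, (∃ x, a.toFun x = u) ∨ ∃ y, b.toFun y = u) ∧
        (∀ x y, a.toFun x = b.toFun y ↔ (x, y) ∈ R.1) ∧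
          ∀ x, (f.toFun x, f.toFun x) ∈ R.1 := by
    rintro ⟨_, W, g, h, hgh, rfl⟩
    obtain ⟨U, a, b, hs, hab⟩ := hY.exists_union_range g h
    exact ⟨U, a, b, hs, hab, hgh.1⟩
  choose Z a b hs hab hfR using hrep
  refine ⟨𝓡, hfin, Z, a, b, fun R => hY.of_jointlySurjective hY (a R) (b R) (hs R),
    fun R x => (hab R _ _).2 (hfR R x), fun W hW g h hgh => ?_⟩
  let β (p : Y.Branch × Bool) : W.Branch :=
    if p.2 then g.toEmbedding.mapBranch p.1 else h.toEmbedding.mapBranch p.1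
  obtain ⟨W', m, k, hW', hmk, hsep⟩ := hX.exists_separated_amalgam hY hW f
    (show Hom X W from (show X ⟶ Y from f) ≫ (show Y ⟶ W from g)) hN₃ β
  -- One copy `k` is separated from both `g` and `h`, so the same argument applies with `l` equal to
  -- either.
  have hlink (l : Hom Y W) (hl : ∀ x, l.toFun (f.toFun x) = g.toFun (f.toFun x))
      (hβ : ∀ b, ∃ p, l.toEmbedding.mapBranch b = β p) :
      ∃ (R : 𝓡) (r : Hom (Z R) W'), (∀ y, r.toFun ((a R).toFun y) = m.toFun (l.toFun y)) ∧
        ∀ y, r.toFun ((b R).toFun y) = k.toFun y := by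
    let q : Hom Y W' := (show Y ⟶ W from l) ≫ (show W ⟶ W' from m)
    have hq : IsSep q k := by
      refine ⟨fun x => ?_, fun b c hbc => ?_⟩
      · exact (congrArg m.toFun (hl x)).trans (hmk x)
      · obtain ⟨p, hp⟩ := hβ b
        refine hsep p c ?_
        rw [← hp]
        exact hbc
    let R : 𝓡 := ⟨Rel q k, W', q, k, hq, rfl⟩
    obtain ⟨r, hr₁, hr₂⟩ := hY.exists_desc hY (a R) (b R) (hs R) q k fun x y => (hab R x y).symm
    exact ⟨R, r, hr₁, hr₂⟩
  exact ⟨W', hW', m, k, hlink g (fun _ => rfl) fun b => ⟨(b, true), by simp [β]⟩,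
    hlink h (fun x => (hgh x).symm) fun b => ⟨(b, false), by simp [β]⟩⟩

end LabeledTree

/-! ### Invariance of the site conditions under equivalence -/

section Transfer

variable {C : Type u₁} [Category.{v₁} C] {D : Type u₂} [Category.{v₁} D] (U : D ⥤ C)
  [U.IsEquivalence]

include U in
theorem rightOreCondition_of_isEquivalence (h : GrothendieckTopology.RightOreCondition C) :
    GrothendieckTopology.RightOreCondition D := by
  intro X Y Z f g
  obtain ⟨W, p, q, hpq⟩ := h (U.map f) (U.map g)
  refine ⟨U.objPreimage W, U.preimage ((U.objObjPreimageIso W).hom ≫ p),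
    U.preimage ((U.objObjPreimageIso W).hom ≫ q), U.map_injective ?_⟩
  simp [hpq]

include U in
theorem HasFiniteLinkingFamilies.of_isEquivalence (h : HasFiniteLinkingFamilies C) :
    HasFiniteLinkingFamilies D := by
  intro X Y f
  obtain ⟨ι, hι, Z, a, b, hab, hlink⟩ := h (U.map f)
  refine ⟨ι, hι, fun j => U.objPreimage (Z j),
    fun j => U.preimage ((U.objObjPreimageIso (Z j)).hom ≫ a j),
    fun j => U.preimage ((U.objObjPreimageIso (Z j)).hom ≫ b j),
    fun j => U.map_injective (by simp [hab]), fun W g h' hgh => ?_⟩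
  obtain ⟨W', m, k, ⟨j, r, hr₁, hr₂⟩, ⟨i, s, hs₁, hs₂⟩⟩ := hlink (U.map g) (U.map h')
    (by rw [← U.map_comp, ← U.map_comp, hgh])
  refine ⟨U.objPreimage W', U.preimage ((U.objObjPreimageIso W').hom ≫ m),
    U.preimage ((U.objObjPreimageIso W').hom ≫ k),
    ⟨j, U.preimage ((U.objObjPreimageIso W').hom ≫ r ≫ (U.objObjPreimageIso (Z j)).inv),
      U.map_injective (by simp [hr₁]), U.map_injective (by simp [hr₂])⟩,
    ⟨i, U.preimage ((U.objObjPreimageIso W').hom ≫ s ≫ (U.objObjPreimageIso (Z i)).inv),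
      U.map_injective (by simp [hs₁]), U.map_injective (by simp [hs₂])⟩⟩

end Transfer

/-! ### The site of finitary trees, the one-node tree and the combs -/

namespace FinitaryTree

open FullBinaryTree

variable (I : Type u)

/-- In the opposite category this is amalgamation of spans; nothing has to be separated, so the
family of branches is empty. -/
theorem rightOreCondition_op : GrothendieckTopology.RightOreCondition (FinitaryTree I)ᵒᵖ := by
  intro X Y Z f g
  obtain ⟨N, -, -, hN⟩ := Y.unop.property.exists_depth f.unop.hom
  obtain ⟨U, a, b, hU, hab, -⟩ := X.unop.property.exists_separated_amalgam Y.unop.property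
    Z.unop.property f.unop.hom g.unop.hom hN (ι := PEmpty.{1}) PEmpty.elim
  refine ⟨op ⟨U, hU⟩, Quiver.Hom.op ⟨b⟩, Quiver.Hom.op ⟨a⟩, Quiver.Hom.unop_inj ?_⟩
  exact ObjectProperty.hom_ext _ (LabeledTree.Hom.ext (funext fun x => (hab x).symm))

theorem hasFiniteLinkingFamilies_op : HasFiniteLinkingFamilies (FinitaryTree I)ᵒᵖ := by
  intro X Y f
  obtain ⟨ι, hι, Z, a, b, hZ, hab, hlink⟩ :=
    X.unop.property.exists_finite_linking Y.unop.property f.unop.hom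
  refine ⟨ι, hι, fun j => op ⟨Z j, hZ j⟩, fun j => Quiver.Hom.op ⟨a j⟩,
    fun j => Quiver.Hom.op ⟨b j⟩, fun j => Quiver.Hom.unop_inj ?_, fun W g h hgh => ?_⟩
  · exact ObjectProperty.hom_ext _ (LabeledTree.Hom.ext (funext fun x => hab j x))
  · obtain ⟨W', hW', m, k, ⟨j, r, hr₁, hr₂⟩, ⟨i, s, hs₁, hs₂⟩⟩ :=
      hlink W.unop.obj W.unop.property g.unop.hom h.unop.hom fun x =>
        congrFun (congrArg (fun l => l.unop.hom.toFun) hgh) x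
    refine ⟨op ⟨W', hW'⟩, Quiver.Hom.op ⟨m⟩, Quiver.Hom.op ⟨k⟩,
      ⟨j, Quiver.Hom.op ⟨r⟩, Quiver.Hom.unop_inj ?_, Quiver.Hom.unop_inj ?_⟩,
      ⟨i, Quiver.Hom.op ⟨s⟩, Quiver.Hom.unop_inj ?_, Quiver.Hom.unop_inj ?_⟩⟩
    · exact ObjectProperty.hom_ext _ (LabeledTree.Hom.ext (funext hr₁))
    · exact ObjectProperty.hom_ext _ (LabeledTree.Hom.ext (funext hr₂))
    · exact ObjectProperty.hom_ext _ (LabeledTree.Hom.ext (funext hs₁))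
    · exact ObjectProperty.hom_ext _ (LabeledTree.Hom.ext (funext hs₂))

/-- The tree with a single node. -/
def single : LabeledTree I where
  toFullBinaryTree := ofSet {[]} rfl (by simp) (by simp)
  label := fun _ => none

theorem single_not_child (x y : (single I).Node) : ¬ (single I).Child x y := by
  obtain ⟨⟨y, hy⟩⟩ := y
  rintro ⟨b, hb⟩
  simp [Set.mem_singleton_iff.1 hy] at hb

theorem single_isFinitary : (single I).IsFinitary where
  finite_branch := by
    have : IsEmpty (single I).Branch := ⟨fun b => single_not_child I _ _ (b.2.2 0)⟩
    infer_instance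
  finite_off_branch := by
    convert Set.finite_empty
    exact Set.eq_empty_of_forall_notMem fun y ⟨x, hx, _⟩ => single_not_child I x y hx
  label_isSome b := (single_not_child I _ _ (b.2.2 0)).elim

variable {I} in
theorem single_eq_root (x : (single I).Node) : x = (single I).root := by
  rcases eq_root_or_exists_child x with h | ⟨y, hy⟩
  · exact h
  · exact (single_not_child I _ _ hy).elim

/-- The tree with a single node is initial. -/
def singleIsInitial : IsInitial (⟨single I, single_isFinitary I⟩ : FinitaryTree I) :=
  IsInitial.ofUniqueHom
    (fun _ => ⟨{
      toFun := fun _ => FullBinaryTree.root _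
      injective := fun x y _ => (single_eq_root x).trans (single_eq_root y).symm
      map_root := rfl
      map_child := fun x y => iff_of_false (not_child_root _) (single_not_child I x y)
      map_label := fun b => (single_not_child I _ _ (b.2.2 0)).elim }⟩)
    (fun _ f => ObjectProperty.hom_ext _ (LabeledTree.Hom.ext (funext fun x =>
      (congrArg f.hom.toFun (single_eq_root x)).trans f.hom.map_root)))

variable {I}

/-- The tree consisting of a single branch, labeled by `i`, together with the siblings of its
nodes. -/
def comb (i : I) : LabeledTree I where
  toFullBinaryTree := ofSet {l | ∀ b ∈ l.tail, b = true} (by simp)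
    (fun b l h c hc => h c (List.mem_of_mem_tail hc)) (fun b l h => h)
  label := fun _ => some i

/-- The branch of the comb. -/
def combBranch (i : I) : (comb i).Branch :=
  ⟨fun n => ⟨⟨List.replicate n true,
    fun _ h => List.eq_of_mem_replicate (List.mem_of_mem_tail h)⟩⟩, rfl, fun _ => ⟨true, rfl⟩⟩

theorem comb_isCoding (i : I) : IsCoding (X := (comb i).toFullBinaryTree) fun x => x.down.1 :=
  ofSet_isCoding {l | ∀ b ∈ l.tail, b = true} _
    (fun _ _ h c hc => h c (List.mem_of_mem_tail hc)) (fun _ _ h => h)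

/-- The word of an inner node is the tail of its child's word, hence constantly `true`. -/
theorem comb_eq_combBranch {i : I} {x y : (comb i).Node} (h : (comb i).Child x y) :
    x = (combBranch i).1 (depth x) := by
  obtain ⟨b, hb⟩ := h
  have hx : x.down.1 = List.replicate x.down.1.length true := by
    refine List.eq_replicate_length.2 fun c hc => y.down.2 c ?_
    rw [hb]
    exact hc
  have hd : x.down.1.length = depth x := (comb_isCoding i).length x
  rw [hd] at hx
  exact ULift.ext _ _ (Subtype.ext hx)

theorem comb_isFinitary (i : I) : (comb i).IsFinitary where
  finite_branch := by
    have : Subsingleton (comb i).Branch := by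
      refine ⟨fun b c => Subtype.ext (funext fun n => ?_)⟩
      rw [comb_eq_combBranch (b.2.2 n), comb_eq_combBranch (c.2.2 n), depth_branch, depth_branch]
    infer_instance
  finite_off_branch := by
    convert Set.finite_empty
    exact Set.eq_empty_of_forall_notMem fun y ⟨x, hx, h⟩ =>
      h (combBranch i) _ (comb_eq_combBranch hx).symm
  label_isSome _ := rfl

/-- The functor sending a finitary tree to its set of nodes. -/
def nodes (I : Type u) : FinitaryTree I ⥤ Type u where
  obj X := X.obj.Node
  map f := ↾f.hom.toFun

end FinitaryTree

/-! ### Absence of points and the main theorem -/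

open FullBinaryTree FinitaryTree in
/-- The Malitz--Gregory topos over a set with more than continuum many elements has no points. -/
theorem isEmpty_toposPoint_malitzGregoryTopos {I : Type u}
    (hI : Cardinal.continuum.{u} < Cardinal.mk I)
    (ore : GrothendieckTopology.RightOreCondition (MalitzGregorySite I))
    {T : MalitzGregorySite I} (hT : IsTerminal T) :
    IsEmpty (ToposPoint (MalitzGregoryTopos I ore)) := by
  refine ⟨fun p => hI.not_ge ?_⟩
  obtain ⟨F, hF, hne⟩ := p.exists_isCofiltered_elements ore hT
  let e := equivSmallModel.{u} (FinitaryTree I)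
  let K (i : I) : FinitaryTree I := ⟨comb i, comb_isFinitary i⟩
  let β (i : I) : (e.inverse.obj (e.functor.obj (K i))).obj.Branch :=
    (e.unit.app (K i)).hom.toEmbedding.mapBranch (combBranch i)
  have hβ (i : I) : (e.inverse.obj (e.functor.obj (K i))).obj.label (β i) = some i :=
    (e.unit.app (K i)).hom.map_label (combBranch i) i rfl
  refine mk_le_continuum_of_isCofiltered_elements F
    (unopUnop (SmallModel.{u} (FinitaryTree I)) ⋙ e.inverse ⋙ nodes I)
    (fun i => op (e.functor.obj (K i))) (fun i => (hne _).some) (fun i n => (β i).1 n)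
    (fun X Y f => (e.inverse.map f.unop).hom.injective) (fun n => ⟨2 ^ n + 1, fun W i a => ?_⟩)
    fun i j W a b hab => ?_
  -- Embeddings preserve depth, so the nodes in question have codes of length `n`, of which there
  -- are only `2 ^ n`.
  · obtain ⟨φ, hφ⟩ := exists_isCoding (e.inverse.obj W.unop).obj.toFullBinaryTree
    let x (m : Fin (2 ^ n + 1)) : (e.inverse.obj W.unop).obj.Node :=
      (e.inverse.map (a m).unop).hom.toFun ((β (i m)).1 n)
    have hx (m : Fin (2 ^ n + 1)) : (φ (x m)).length = n := by
      rw [hφ.length, Embedding.depth_apply, depth_branch]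
    let v (m : Fin (2 ^ n + 1)) : List.Vector Bool n := ⟨φ (x m), hx m⟩
    obtain ⟨m, m', hne, h⟩ := Fintype.exists_ne_map_eq_of_card_lt v (by simp)
    exact ⟨m, m', hne, hφ.injective (congrArg Subtype.val h)⟩
  -- If the two image branches coincide, that branch carries both labels `i` and `j`.
  · have h1 := (e.inverse.map a.unop).hom.map_label (β i) i (hβ i)
    have h2 := (e.inverse.map b.unop).hom.map_label (β j) j (hβ j)
    have h3 : (e.inverse.map a.unop).hom.toEmbedding.mapBranch (β i) =
        (e.inverse.map b.unop).hom.toEmbedding.mapBranch (β j) := Subtype.ext (funext hab)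
    rw [h3, h2] at h1
    exact (Option.some_injective _ h1).symm

theorem mainTheorem1 :
    (∀ (I : Type u), Cardinal.continuum.{u} < Cardinal.mk I →
      ∃ ore : GrothendieckTopology.RightOreCondition (MalitzGregorySite I),
        IsConnectedTopos (MalitzGregoryTopos I ore) ∧
        IsAtomicTopos (MalitzGregoryTopos I ore) ∧
        IsLocallyFinitelyPresentable.{u} (MalitzGregoryTopos I ore) ∧
        IsEmpty (ToposPoint (MalitzGregoryTopos I ore)) ∧
        ¬ HasEnoughToposPoints (MalitzGregoryTopos I ore)) ∧
    ¬ DiLibertiRogersConjecture.{u} := by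
  have main (I : Type u) (hI : Cardinal.continuum.{u} < Cardinal.mk I) :
      ∃ ore : GrothendieckTopology.RightOreCondition (MalitzGregorySite I),
        IsConnectedTopos (MalitzGregoryTopos I ore) ∧
        IsAtomicTopos (MalitzGregoryTopos I ore) ∧
        IsLocallyFinitelyPresentable.{u} (MalitzGregoryTopos I ore) ∧
        IsEmpty (ToposPoint (MalitzGregoryTopos I ore)) ∧
        ¬ HasEnoughToposPoints (MalitzGregoryTopos I ore) := by
    let U : MalitzGregorySite I ⥤ (FinitaryTree I)ᵒᵖ :=
      (equivSmallModel.{u} (FinitaryTree I)).inverse.op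
    have ore : GrothendieckTopology.RightOreCondition (MalitzGregorySite I) :=
      rightOreCondition_of_isEquivalence U (FinitaryTree.rightOreCondition_op I)
    have hT := terminalOpOfInitial (IsInitial.isInitialObj
      (equivSmallModel.{u} (FinitaryTree I)).functor _ (FinitaryTree.singleIsInitial I))
    have hp := isEmpty_toposPoint_malitzGregoryTopos hI ore hT
    have : Nonempty (MalitzGregorySite I) :=
      ⟨op ((equivSmallModel.{u} (FinitaryTree I)).functor.obj
        ⟨FinitaryTree.single I, FinitaryTree.single_isFinitary I⟩)⟩
    exact ⟨ore, isConnectedTopos_sheaf_atomic ore hT, isAtomicTopos_sheaf_atomic ore hT,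
      isLocallyFinitelyPresentable_sheaf_atomic ore
        ((FinitaryTree.hasFiniteLinkingFamilies_op I).of_isEquivalence U),
      hp, not_hasEnoughToposPoints_of_isEmpty ore hp⟩
  refine ⟨main, fun h => ?_⟩
  -- The double power set of `ℕ` exceeds the continuum by Cantor's theorem; `ULift` places it in the
  -- universe `u`.
  obtain ⟨ore, -, -, hfp, -, hE⟩ := main (ULift.{u} (Set (Set ℕ))) (by
    rw [Cardinal.mk_uLift, Cardinal.mk_set, Cardinal.mk_set, Cardinal.mk_nat]
    simpa using Cardinal.cantor (2 ^ Cardinal.aleph0))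
  exact hE (h _ ⟨_, inferInstance, _, ⟨CategoryTheory.Equivalence.refl⟩⟩ hfp)
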